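/- Let $\Omega\subset\mathbb R^2$ be a bounded domain with polygonal boundary, and let $C_{\mathcal T},c_0,c_1,c_2,c_3>0$. All function spaces are complex; $\|\cdot\|$ denotes the product norm of $H^2(\Omega)\times H^1(\Omega)$ on $H^2_0(\Omega)\times H^1_0(\Omega)$. A mesh $\mathcal T_h$ is a decomposition of $\Omega$ into finitely many pairwise disjoint polygons $K$ (bounded open simply connected sets whose boundary is a non-self-intersecting closed line made of finitely many segments), with diameters $h_K$, such that every edge of $K$ is longer than $C_{\mathcal T}h_K$ and $K$ is star-shaped with respect to every point of a ball of radius $C_{\mathcal T}h_K$. Put $$a_K^\Delta(u,v)=\int_K D^2u:D^2\overline v,\qquad a_K^\nabla(\phi,\psi)=\int_K\nabla\phi\cdot\nabla\overline\psi .$$ Let $P_1,\dots,P_{N_K}$ be the vertices of $K$ and let $\mathbb P_k$ be the polynomials of degree at most $k$. Define \begin{align*} \widetilde W_h^K&=\{v\in H^2(K):\Delta^2v\in\mathbb P_2(K),\ v|_{\partial K}\in C^0(\partial K),\ v|_e\in\mathbb P_3(e),\ \nabla v|_{\partial K}\in C^0(\partial K)^2,\ \partial_\nu v|_e\in\mathbb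 P_1(e)\ \text{for all edges } e\},\\ \widetilde V_h^K&=\{\psi\in H^1(K):\Delta\psi\in\mathbb P_1(K),\ \psi|_{\partial K}\in C^0(\partial K),\ \psi|_e\in\mathbb P_1(e)\ \text{for all edges } e\}. \end{align*} Let $\Pi_2^\Delta v\in\mathbb P_2(K)$ be given by $a_K^\Delta(\Pi_2^\Delta v,q)=a_K^\Delta(v,q)$ for $q\in\mathbb P_2(K)$ and $\sum_i(\Pi_2^\Delta v)(P_i)q(P_i)=\sum_i v(P_i)q(P_i)$ for $q\in\mathbb P_1(K)$; let $\Pi_1^\nabla\psi\in\mathbb P_1(K)$ be given by $a_K^\nabla(\Pi_1^\nabla\psi,q)=a_K^\nabla(\psi,q)$ for $q\in\mathbb P_1(K)$ and $\int_{\partial K}\Pi_1^\nabla\psi=\int_{\partial K}\psi$. Put \begin{align*} W_h^K&=\Big\{v\in\widetilde W_h^K:\int_K(\Pi_2^\Delta v)q=\int_Kvq\ \ \forall q\in\mathbb P_2(K)\Big\},& V_h^K&=\Big\{\psi\in\widetilde V_h^K:\int_K(\Pi_1^\nabla\psi)q=\int_K\psi q\ \ \forall q\in\mathbb P_1(K)\Big\},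 \end{align*} and $Z_h=W_h\times V_h$ with $W_h=\{v\in H_0^2(\Omega):v|_K\in W_h^K\ \forall K\in\mathcal T_h\}$ and $V_h=\{\psi\in H^1_0(\Omega):\psi|_K\in V_h^K\ \forall K\in\mathcal T_h\}$. For every $K\in\mathcal T_h$ let $s_K^\Delta$ on $W_h^K$ and $s_K^\nabla$ on $V_h^K$ be symmetric (Hermitian) positive definite sesquilinear forms with \begin{align*} c_0a_K^\Delta(v,v)\le s_K^\Delta(v,v)\le c_1a_K^\Delta(v,v)&\quad\text{for all } v\in W_h^K\text{ with }\Pi_2^\Delta v=0,\\ c_2a_K^\nabla(\psi,\psi)\le s_K^\nabla(\psi,\psi)\le c_3a_K^\nabla(\psi,\psi)&\quad\text{for all } \psi\in V_h^K\text{ with }\Pi_1^\nabla\psi=0, \end{align*} and define on $Z_h\times Z_h$ \begin{align*} a_h((u,\phi),(v,\psi))=\sum_{K\in\mathcal T_h}\Big[&a_K^\Delta(\Pi_2^\Delta u,\Pi_2^\Delta v)+s_K^\Delta(u-\Pi_2^\Delta u,v-\Pi_2^\Delta v)\\ &+a_K^\nabla(\Pi_1^\nabla\phi,\Pi_1^\nabla\psi)+s_K^\nabla(\phi-\Pi_1^\nabla\phi,\psi-\Pi_1^\nabla\psi)\Big].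 \end{align*} Then there is a constant $\beta>0$, depending only on $\Omega,C_{\mathcal T},c_0,\dots,c_3$ (in particular neither on the mesh, hence not on $h$, nor on the choice of the forms $s_K^\Delta,s_K^\nabla$), such that $a_h((v_h,\psi_h),(v_h,\psi_h))$ is real and $$a_h((v_h,\psi_h),(v_h,\psi_h))\ \ge\ \beta\,\|(v_h,\psi_h)\|^2\qquad\text{for all }(v_h,\psi_h)\in Z_h .$$ -/

import Mathlib

open MeasureTheory Filter Topology Set
open scoped ENNReal ContDiff ComplexConjugate Distributions LineDeriv

namespace VEM

noncomputable section

/-! ## Sobolev spaces on open subsets of the plane -/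

/-- The Euclidean plane. -/
abbrev Plane : Type := EuclideanSpace ℝ (Fin 2)

/-- The coordinate unit vectors. -/
def e (i : Fin 2) : Plane := EuclideanSpace.single i (1 : ℝ)

/-- Complex-valued square integrable functions (classes) on the open set `U`. -/
abbrev L2 (U : TopologicalSpace.Opens Plane) : Type :=
  Lp ℂ 2 ((volume : Measure Plane).restrict (U : Set Plane))

/-- `g` is the weak partial derivative `∂ᵢ f` on `U`. -/
def HasWeakDeriv (U : TopologicalSpace.Opens Plane) (i : Fin 2) (f g : L2 U) : Prop :=
  ∀ φ : 𝓓(U, ℂ), ∫ x in (U : Set Plane), f x * (∂_{e i} φ) x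
    = - ∫ x in (U : Set Plane), g x * φ x

open Classical in
/-- The weak partial derivative in `L²(U)` (zero if there is none). -/
def wd (U : TopologicalSpace.Opens Plane) (i : Fin 2) (f : L2 U) : L2 U :=
  if h : ∃ g, HasWeakDeriv U i f g then h.choose else 0

section basics

variable {U : TopologicalSpace.Opens Plane}

theorem memLp_test (φ : 𝓓(U, ℂ)) (μ : Measure Plane) [IsFiniteMeasureOnCompacts μ] :
    MemLp (φ : Plane → ℂ) 2 μ :=
  φ.continuous.memLp_of_hasCompactSupport φ.hasCompactSupport

theorem integrable_mul_test (f : L2 U) (φ : 𝓓(U, ℂ)) :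
    Integrable (fun x => f x * φ x) ((volume : Measure Plane).restrict (U : Set Plane)) :=
  (Lp.memLp f).integrable_mul (memLp_test φ _)

theorem integral_add_mul {f g : L2 U} {h : Plane → ℂ}
    (hf : Integrable (fun x => f x * h x) (volume.restrict (U : Set Plane)))
    (hg : Integrable (fun x => g x * h x) (volume.restrict (U : Set Plane))) :
    ∫ x in (U : Set Plane), (f + g : L2 U) x * h x
      = (∫ x in (U : Set Plane), f x * h x) + ∫ x in (U : Set Plane), g x * h x := by
  rw [← integral_add hf hg]
  refine integral_congr_ae ?_
  filter_upwards [Lp.coeFn_add f g] with x hx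
  rw [hx, Pi.add_apply, add_mul]

theorem integral_smul_mul (c : ℂ) (f : L2 U) (h : Plane → ℂ) :
    ∫ x in (U : Set Plane), (c • f : L2 U) x * h x
      = c * ∫ x in (U : Set Plane), f x * h x := by
  rw [← integral_const_mul]
  refine integral_congr_ae ?_
  filter_upwards [Lp.coeFn_smul c f] with x hx
  rw [hx, Pi.smul_apply, smul_eq_mul, mul_assoc]

theorem HasWeakDeriv.add {i : Fin 2} {f g f' g' : L2 U} (hf : HasWeakDeriv U i f f')
    (hg : HasWeakDeriv U i g g') : HasWeakDeriv U i (f + g) (f' + g') := by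
  intro φ
  rw [integral_add_mul (integrable_mul_test f _) (integrable_mul_test g _),
    integral_add_mul (integrable_mul_test f' _) (integrable_mul_test g' _), hf φ, hg φ, neg_add]

theorem HasWeakDeriv.smul {i : Fin 2} (c : ℂ) {f f' : L2 U} (hf : HasWeakDeriv U i f f') :
    HasWeakDeriv U i (c • f) (c • f') := by
  intro φ
  rw [integral_smul_mul, integral_smul_mul, hf φ, mul_neg]

theorem eq_zero_of_test {f : L2 U}
    (h : ∀ φ : 𝓓(U, ℂ), ∫ x in (U : Set Plane), f x * φ x = 0) : f = 0 := by
  have hloc : LocallyIntegrableOn (f : Plane → ℂ) (U : Set Plane) volume := by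
    refine (locallyIntegrableOn_iff U.isOpen.isLocallyClosed).2 fun k hk hkc => ?_
    have h1 : MemLp (f : Plane → ℂ) 2 (volume.restrict k) :=
      (Lp.memLp f).mono_measure (Measure.restrict_mono hk le_rfl)
    have : IsFiniteMeasure ((volume : Measure Plane).restrict k) :=
      ⟨by simpa using hkc.measure_lt_top⟩
    exact h1.integrable (by norm_num)
  have h0 : ∀ᵐ x ∂(volume : Measure Plane), x ∈ (U : Set Plane) → (f : Plane → ℂ) x = 0 := by
    refine U.isOpen.ae_eq_zero_of_integral_contDiff_smul_eq_zero hloc ?_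
    intro g hg hgc hgs
    have hts : tsupport (fun x => ((g x : ℝ) : ℂ)) ⊆ tsupport g :=
      closure_mono fun x hx => by
        simp only [Function.mem_support, ne_eq, Complex.ofReal_eq_zero] at hx ⊢
        exact hx
    let φ : 𝓓(U, ℂ) :=
      { toFun := fun x => ((g x : ℝ) : ℂ)
        contDiff' := Complex.ofRealCLM.contDiff.comp hg
        hasCompactSupport' := hgc.mono' ((subset_tsupport _).trans hts)
        tsupport_subset' := hts.trans hgs }
    have h2 := h φ
    have h3 : ∫ x, g x • f x ∂(volume : Measure Plane)
        = ∫ x in (U : Set Plane), g x • f x := by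
      refine (setIntegral_eq_integral_of_forall_compl_eq_zero fun x hx => ?_).symm
      have : g x = 0 := image_eq_zero_of_notMem_tsupport fun h' => hx (hgs h')
      simp [this]
    rw [h3, ← h2]
    refine integral_congr_ae (Eventually.of_forall fun x => ?_)
    change g x • f x = f x * ((g x : ℝ) : ℂ)
    rw [mul_comm, Complex.real_smul]
  rw [Lp.eq_zero_iff_ae_eq_zero]
  exact (ae_restrict_iff' U.isOpen.measurableSet).2 h0

theorem HasWeakDeriv.unique {i : Fin 2} {f g g' : L2 U} (h : HasWeakDeriv U i f g)
    (h' : HasWeakDeriv U i f g') : g = g' := by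
  rw [← sub_eq_zero]
  refine eq_zero_of_test fun φ => ?_
  have : g - g' = g + (-1 : ℂ) • g' := by simp [sub_eq_add_neg]
  rw [this, integral_add_mul (integrable_mul_test g _)
    (integrable_mul_test ((-1 : ℂ) • g') _), integral_smul_mul]
  have h1 := h φ
  rw [h' φ] at h1
  linear_combination h1

theorem HasWeakDeriv.wd_eq {i : Fin 2} {f g : L2 U} (h : HasWeakDeriv U i f g) :
    wd U i f = g := by
  have hex : ∃ g, HasWeakDeriv U i f g := ⟨g, h⟩
  rw [wd, dif_pos hex]
  exact hex.choose_spec.unique h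

theorem hasWeakDeriv_zero (i : Fin 2) : HasWeakDeriv U i (0 : L2 U) 0 := by
  have h : ∀ h : Plane → ℂ, ∫ x in (U : Set Plane), (0 : L2 U) x * h x = 0 := by
    intro h
    have := integral_smul_mul (U := U) 0 (0 : L2 U) h
    rwa [zero_smul, zero_mul] at this
  intro φ
  rw [h, h, neg_zero]

end basics

/-- The Sobolev space `H¹(U)`. -/
def H1 (U : TopologicalSpace.Opens Plane) : Submodule ℂ (L2 U) where
  carrier := {f | ∀ i, ∃ g, HasWeakDeriv U i f g}
  zero_mem' := fun i => ⟨0, hasWeakDeriv_zero i⟩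
  add_mem' := fun hf hg i =>
    let ⟨f', hf'⟩ := hf i
    let ⟨g', hg'⟩ := hg i
    ⟨f' + g', hf'.add hg'⟩
  smul_mem' := fun c _ hf i =>
    let ⟨f', hf'⟩ := hf i
    ⟨c • f', hf'.smul c⟩

section H1lemmas

variable {U : TopologicalSpace.Opens Plane}

theorem hasWeakDeriv_wd {f : L2 U} (hf : f ∈ H1 U) (i : Fin 2) :
    HasWeakDeriv U i f (wd U i f) := by
  obtain ⟨g, hg⟩ := hf i
  rwa [hg.wd_eq]

theorem wd_zero (i : Fin 2) : wd U i (0 : L2 U) = 0 := (hasWeakDeriv_zero i).wd_eq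

theorem wd_add {f g : L2 U} (hf : f ∈ H1 U) (hg : g ∈ H1 U) (i : Fin 2) :
    wd U i (f + g) = wd U i f + wd U i g :=
  ((hasWeakDeriv_wd hf i).add (hasWeakDeriv_wd hg i)).wd_eq

theorem wd_smul (c : ℂ) {f : L2 U} (hf : f ∈ H1 U) (i : Fin 2) :
    wd U i (c • f) = c • wd U i f :=
  ((hasWeakDeriv_wd hf i).smul c).wd_eq

end H1lemmas

/-- The Sobolev space `H²(U)`. -/
def H2 (U : TopologicalSpace.Opens Plane) : Submodule ℂ (L2 U) where
  carrier := {f | f ∈ H1 U ∧ ∀ i, wd U i f ∈ H1 U}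
  zero_mem' := ⟨(H1 U).zero_mem, fun i => by rw [wd_zero]; exact (H1 U).zero_mem⟩
  add_mem' := fun hf hg =>
    ⟨(H1 U).add_mem hf.1 hg.1, fun i => by
      rw [wd_add hf.1 hg.1]; exact (H1 U).add_mem (hf.2 i) (hg.2 i)⟩
  smul_mem' := fun c _ hf =>
    ⟨(H1 U).smul_mem c hf.1, fun i => by
      rw [wd_smul c hf.1]; exact (H1 U).smul_mem c (hf.2 i)⟩

/-- The square of the `H¹(U)` norm. -/
def normH1Sq (U : TopologicalSpace.Opens Plane) (f : L2 U) : ℝ :=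
  ‖f‖ ^ 2 + ∑ i, ‖wd U i f‖ ^ 2

/-- The square of the `H²(U)` norm. -/
def normH2Sq (U : TopologicalSpace.Opens Plane) (f : L2 U) : ℝ :=
  ‖f‖ ^ 2 + ∑ i, ‖wd U i f‖ ^ 2 + ∑ i, ∑ j, ‖wd U j (wd U i f)‖ ^ 2

/-- The product norm of `H²(U) × H¹(U)`. -/
def prodNorm (U : TopologicalSpace.Opens Plane) (v ψ : L2 U) : ℝ :=
  √(normH2Sq U v + normH1Sq U ψ)

/-- The `L²(U)` distance of two functions. -/
def distL2 (U : TopologicalSpace.Opens Plane) (f g : Plane → ℂ) : ℝ≥0∞ :=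
  eLpNorm (fun x => f x - g x) 2 ((volume : Measure Plane).restrict (U : Set Plane))

/-- `H¹₀(U)`: the closure of the test functions in `H¹(U)`. -/
def H10 (U : TopologicalSpace.Opens Plane) : Set (L2 U) :=
  {f | f ∈ H1 U ∧ ∀ ε : ℝ≥0∞, 0 < ε → ∃ φ : 𝓓(U, ℂ),
    distL2 U φ f < ε ∧ ∀ i, distL2 U (∂_{e i} φ : 𝓓(U, ℂ)) (wd U i f) < ε}

/-- `H²₀(U)`: the closure of the test functions in `H²(U)`. -/
def H20 (U : TopologicalSpace.Opens Plane) : Set (L2 U) :=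
  {f | f ∈ H2 U ∧ ∀ ε : ℝ≥0∞, 0 < ε → ∃ φ : 𝓓(U, ℂ),
    distL2 U φ f < ε ∧ (∀ i, distL2 U (∂_{e i} φ : 𝓓(U, ℂ)) (wd U i f) < ε) ∧
    ∀ i j, distL2 U (∂_{e j} (∂_{e i} φ : 𝓓(U, ℂ)) : 𝓓(U, ℂ)) (wd U j (wd U i f)) < ε}

/-- Restriction of a function on `U` to a smaller open set `V`. -/
def restr {U V : TopologicalSpace.Opens Plane} (h : V ≤ U) (f : L2 U) : L2 V :=
  ((Lp.memLp f).mono_measure (Measure.restrict_mono h le_rfl)).toLp f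

/-! ## Polygonal domains, polygons and meshes -/

/-- A bounded domain whose boundary consists of finitely many segments. -/
def IsPolygonalDomain (Ω : TopologicalSpace.Opens Plane) : Prop :=
  IsConnected (Ω : Set Plane) ∧ Bornology.IsBounded (Ω : Set Plane) ∧
    ∃ S : Finset (Plane × Plane), frontier (Ω : Set Plane) = ⋃ p ∈ S, segment ℝ p.1 p.2

/-- A polygon: a bounded open simply connected set whose boundary is the simple closed polygonal
line through the `n + 3` vertices `vertex 0, …, vertex (n + 2)` (indices are cyclic; consecutive
edges may be aligned). -/
structure Polygon where
  n : ℕ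
  vertex : Fin (n + 3) → Plane
  interior : TopologicalSpace.Opens Plane
  vertex_injective : Function.Injective vertex
  simple : ∀ i j, i ≠ j → ∀ x ∈ segment ℝ (vertex i) (vertex (i + 1)),
    x ∈ segment ℝ (vertex j) (vertex (j + 1)) →
    (j = i + 1 ∧ x = vertex j) ∨ (i = j + 1 ∧ x = vertex i)
  isBounded : Bornology.IsBounded (interior : Set Plane)
  simplyConnected : IsSimplyConnected (interior : Set Plane)
  frontier_eq : frontier (interior : Set Plane) =
    ⋃ i, segment ℝ (vertex i) (vertex (i + 1))

namespace Polygon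

/-- The parametrization of the `i`-th edge by `t ∈ [0, 1]`. -/
def edge (K : Polygon) (i : Fin (K.n + 3)) (t : ℝ) : Plane :=
  AffineMap.lineMap (K.vertex i) (K.vertex (i + 1)) t

/-- The length of the `i`-th edge. -/
def edgeLength (K : Polygon) (i : Fin (K.n + 3)) : ℝ :=
  dist (K.vertex i) (K.vertex (i + 1))

/-- The diameter `h_K`. -/
def diam (K : Polygon) : ℝ := Metric.diam (K.interior : Set Plane)

/-- A unit normal to the `i`-th edge. Its orientation depends on that of the vertex list; it
enters below only through conditions that do not see its sign. -/
def normal (K : Polygon) (i : Fin (K.n + 3)) : Plane :=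
  (K.edgeLength i)⁻¹ •
    !₂[(K.vertex (i + 1)) 1 - (K.vertex i) 1, (K.vertex i) 0 - (K.vertex (i + 1)) 0]

end Polygon

/-- A decomposition of `Ω` into finitely many polygons. -/
structure Mesh (Ω : TopologicalSpace.Opens Plane) where
  card : ℕ
  elem : Fin card → Polygon
  disjoint : ∀ k l, k ≠ l → Disjoint (elem k).interior (elem l).interior
  le : ∀ k, (elem k).interior ≤ Ω
  cover : closure (Ω : Set Plane) = ⋃ k, closure ((elem k).interior : Set Plane)

/-- The ratio between the shortest edge and the diameter of each element is larger than `C`. -/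
def Mesh.A1 {Ω : TopologicalSpace.Opens Plane} (T : Mesh Ω) (C : ℝ) : Prop :=
  ∀ k i, C * (T.elem k).diam < (T.elem k).edgeLength i

/-- Each element `K` is star-shaped with respect to every point of a ball of radius `C h_K`. -/
def Mesh.A2 {Ω : TopologicalSpace.Opens Plane} (T : Mesh Ω) (C : ℝ) : Prop :=
  ∀ k, ∃ x, ∀ y ∈ Metric.ball x (C * (T.elem k).diam),
    StarConvex ℝ y ((T.elem k).interior : Set Plane)

/-! ## Traces -/

/-- `τ` is (on `∂K`, up to null sets) the trace of `f ∈ H¹(K)`: there are functions smooth on the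
whole plane that converge to `f` in `H¹(K)` and whose restrictions to each edge converge to `τ`
in `L²`. -/
def IsTrace (K : Polygon) (f : L2 K.interior) (τ : Plane → ℂ) : Prop :=
  f ∈ H1 K.interior ∧
  (∀ i, MemLp (fun t => τ (K.edge i t)) 2 (volume.restrict (Icc (0 : ℝ) 1))) ∧
  ∃ φ : ℕ → Plane → ℂ, (∀ m, ContDiff ℝ ∞ (φ m)) ∧
    Tendsto (fun m => distL2 K.interior (φ m) f) atTop (𝓝 0) ∧
    (∀ i, Tendsto (fun m => distL2 K.interior (fun x => fderiv ℝ (φ m) x (e i))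
      (wd K.interior i f)) atTop (𝓝 0)) ∧
    ∀ i, Tendsto (fun m => eLpNorm (fun t => φ m (K.edge i t) - τ (K.edge i t)) 2
      (volume.restrict (Icc (0 : ℝ) 1))) atTop (𝓝 0)

/-- `f|_{∂K} = τ` with `τ` continuous on `∂K`. -/
def IsContTrace (K : Polygon) (f : L2 K.interior) (τ : Plane → ℂ) : Prop :=
  IsTrace K f τ ∧ ContinuousOn τ (frontier (K.interior : Set Plane))

/-- `τ` is on the `i`-th edge of `K` a polynomial of degree at most `k`. -/
def IsEdgePoly (K : Polygon) (k : ℕ) (i : Fin (K.n + 3)) (τ : Plane → ℂ) : Prop :=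
  ∃ q : Polynomial ℂ, q.natDegree ≤ k ∧ ∀ t ∈ Icc (0 : ℝ) 1, τ (K.edge i t) = q.eval (t : ℂ)

/-- The boundary integral `(τ, 1)_{∂K}`. -/
def bdryIntegral (K : Polygon) (τ : Plane → ℂ) : ℂ :=
  ∑ i, (K.edgeLength i : ℂ) * ∫ t in (0 : ℝ)..1, τ (K.edge i t)

/-! ## Polynomials -/

/-- The polynomials of degree at most `k` in two variables. -/
abbrev P (k : ℕ) : Submodule ℂ (MvPolynomial (Fin 2) ℂ) :=
  MvPolynomial.restrictTotalDegree (Fin 2) ℂ k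

/-- The function on the plane given by a polynomial. -/
def polyFun (p : MvPolynomial (Fin 2) ℂ) (x : Plane) : ℂ :=
  MvPolynomial.eval (fun i => ((x i : ℝ) : ℂ)) p

theorem polyFun_contDiff (p : MvPolynomial (Fin 2) ℂ) : ContDiff ℝ ∞ (polyFun p) := by
  induction p using MvPolynomial.induction_on with
  | C a =>
    have : polyFun (MvPolynomial.C a) = fun _ => a := by ext x; simp [polyFun]
    rw [this]; exact contDiff_const
  | add p q hp hq =>
    have : polyFun (p + q) = fun x => polyFun p x + polyFun q x := by ext x; simp [polyFun]
    rw [this]; exact hp.add hq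
  | mul_X p i hp =>
    have : polyFun (p * MvPolynomial.X i) = fun x => polyFun p x * ((x i : ℝ) : ℂ) := by
      ext x; simp [polyFun]
    rw [this]
    refine hp.mul (Complex.ofRealCLM.contDiff.comp ?_)
    fun_prop

theorem polyFun_continuous (p : MvPolynomial (Fin 2) ℂ) : Continuous (polyFun p) :=
  (polyFun_contDiff p).continuous

theorem polyFun_differentiable (p : MvPolynomial (Fin 2) ℂ) : Differentiable ℝ (polyFun p) :=
  (polyFun_contDiff p).differentiable (by simp)

theorem fderiv_polyFun (p : MvPolynomial (Fin 2) ℂ) (i : Fin 2) (x : Plane) :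
    fderiv ℝ (polyFun p) x (e i) = polyFun (MvPolynomial.pderiv i p) x := by
  induction p using MvPolynomial.induction_on with
  | C a =>
    have : polyFun (MvPolynomial.C a) = fun _ => a := by ext x; simp [polyFun]
    rw [this]; simp [polyFun]
  | add p q hp hq =>
    have : polyFun (p + q) = polyFun p + polyFun q := by ext x; simp [polyFun]
    rw [this, fderiv_add (polyFun_differentiable p x) (polyFun_differentiable q x)]
    simp [hp, hq, polyFun]
  | mul_X p j hp =>
    have hX : HasFDerivAt (fun x : Plane => ((x j : ℝ) : ℂ))
        (Complex.ofRealCLM.comp (EuclideanSpace.proj j : Plane →L[ℝ] ℝ)) x :=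
      (Complex.ofRealCLM.comp (EuclideanSpace.proj j : Plane →L[ℝ] ℝ)).hasFDerivAt
    have : polyFun (p * MvPolynomial.X j) = fun x => polyFun p x * ((x j : ℝ) : ℂ) := by
      ext x; simp [polyFun]
    have hm := ((polyFun_differentiable p x).hasFDerivAt.mul hX).fderiv
    rw [this]
    change fderiv ℝ (polyFun p * fun x : Plane => ((x j : ℝ) : ℂ)) x (e i) = _
    rw [hm]
    have hd : polyFun (MvPolynomial.pderiv i (p * MvPolynomial.X j)) x
        = polyFun (MvPolynomial.pderiv i p) x * ((x j : ℝ) : ℂ)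
          + polyFun p x * polyFun (MvPolynomial.pderiv i (MvPolynomial.X j)) x := by
      simp [polyFun]
      ring
    rw [hd, ← hp]
    by_cases hij : i = j
    · subst hij
      simp [polyFun, e]
      ring
    · have hji : j ≠ i := fun h => hij h.symm
      simp [polyFun, MvPolynomial.pderiv_X_of_ne hji, e, hji]
      ring

theorem pderiv_mem_P {k : ℕ} {p : MvPolynomial (Fin 2) ℂ} (hp : p ∈ P (k + 1)) (i : Fin 2) :
    MvPolynomial.pderiv i p ∈ P k := by
  rw [MvPolynomial.mem_restrictTotalDegree] at hp ⊢
  refine Finset.sup_le fun m hm => ?_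
  rw [MvPolynomial.mem_support_iff, MvPolynomial.coeff_pderiv] at hm
  have h1 : MvPolynomial.coeff (m + Finsupp.single i 1) p ≠ 0 := fun h => hm (by simp [h])
  have h2 := MvPolynomial.le_totalDegree (MvPolynomial.mem_support_iff.2 h1)
  rw [Finsupp.sum_add_index' (by simp) (by simp), Finsupp.sum_single_index rfl] at h2
  omega

theorem P_mono {k l : ℕ} (h : k ≤ l) {p : MvPolynomial (Fin 2) ℂ} (hp : p ∈ P k) : p ∈ P l := by
  rw [MvPolynomial.mem_restrictTotalDegree] at hp ⊢
  exact hp.trans h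

theorem polyFun_memLp (K : Polygon) (p : MvPolynomial (Fin 2) ℂ) :
    MemLp (polyFun p) 2 ((volume : Measure Plane).restrict (K.interior : Set Plane)) := by
  have : IsFiniteMeasure ((volume : Measure Plane).restrict (K.interior : Set Plane)) :=
    ⟨by simpa using K.isBounded.measure_lt_top⟩
  obtain ⟨C, hC⟩ := K.isBounded.isCompact_closure.exists_bound_of_continuousOn
    (polyFun_continuous p).continuousOn
  refine MemLp.of_bound (polyFun_continuous p).aestronglyMeasurable C ?_
  exact (ae_restrict_iff' K.interior.isOpen.measurableSet).2
    (Eventually.of_forall fun x hx => hC x (subset_closure hx))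

/-- The restriction of a polynomial to `K`, as an element of `L²(K)`. -/
def polyL2 (K : Polygon) : MvPolynomial (Fin 2) ℂ →ₗ[ℂ] L2 K.interior where
  toFun p := (polyFun_memLp K p).toLp _
  map_add' p q := by
    rw [← MemLp.toLp_add]
    congr 1
    ext x; simp [polyFun]
  map_smul' c p := by
    rw [RingHom.id_apply, ← MemLp.toLp_const_smul]
    congr 1
    ext x; simp [polyFun, MvPolynomial.smul_eval]

theorem polyL2_ae (K : Polygon) (p : MvPolynomial (Fin 2) ℂ) :
    polyL2 K p =ᵐ[(volume : Measure Plane).restrict (K.interior : Set Plane)] polyFun p :=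
  MemLp.coeFn_toLp (polyFun_memLp K p)

theorem integral_polyL2_mul (K : Polygon) (p : MvPolynomial (Fin 2) ℂ) (h : Plane → ℂ) :
    ∫ x in (K.interior : Set Plane), polyL2 K p x * h x
      = ∫ x in (K.interior : Set Plane), polyFun p x * h x := by
  refine integral_congr_ae ?_
  filter_upwards [polyL2_ae K p] with x hx
  rw [hx]

theorem hasWeakDeriv_polyL2 (K : Polygon) (p : MvPolynomial (Fin 2) ℂ) (i : Fin 2) :
    HasWeakDeriv K.interior i (polyL2 K p) (polyL2 K (MvPolynomial.pderiv i p)) := by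
  intro φ
  have hset : ∀ (f : Plane → ℂ) (χ : 𝓓(K.interior, ℂ)),
      ∫ x in (K.interior : Set Plane), f x * χ x = ∫ x, f x * χ x := by
    intro f χ
    refine setIntegral_eq_integral_of_forall_compl_eq_zero fun x hx => ?_
    rw [image_eq_zero_of_notMem_tsupport fun h => hx (χ.tsupport_subset h), mul_zero]
  have hint : ∀ (q : MvPolynomial (Fin 2) ℂ) (χ : 𝓓(K.interior, ℂ)),
      Integrable (fun x => polyFun q x * χ x) (volume : Measure Plane) := fun q χ =>
    ((polyFun_continuous q).mul χ.continuous).integrable_of_hasCompactSupport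
      χ.hasCompactSupport.mul_left
  have hφd : Differentiable ℝ (φ : Plane → ℂ) := φ.contDiff.differentiable (by simp)
  have hd : ∀ x, (∂_{e i} φ : 𝓓(K.interior, ℂ)) x = fderiv ℝ φ x (e i) := by
    intro x
    rw [TestFunction.lineDerivOp_eq_lineDerivCLM ℝ, TestFunction.lineDerivCLM_apply,
      if_pos (by simp), (hφd x).lineDeriv_eq_fderiv]
  rw [integral_polyL2_mul, integral_polyL2_mul, hset, hset]
  have key := integral_mul_fderiv_eq_neg_fderiv_mul_of_integrable
    (μ := (volume : Measure Plane)) (f := polyFun p) (g := φ) (v := e i)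
    (by simpa only [fderiv_polyFun] using hint (MvPolynomial.pderiv i p) φ)
    (by simpa only [hd] using hint p (∂_{e i} φ : 𝓓(K.interior, ℂ)))
    (hint p φ) (fun x _ => polyFun_differentiable p x) (fun x _ => hφd x)
  simpa only [hd, fderiv_polyFun] using key

theorem polyL2_mem_H1 (K : Polygon) (p : MvPolynomial (Fin 2) ℂ) :
    polyL2 K p ∈ H1 K.interior := fun i => ⟨_, hasWeakDeriv_polyL2 K p i⟩

theorem wd_polyL2 (K : Polygon) (p : MvPolynomial (Fin 2) ℂ) (i : Fin 2) :
    wd K.interior i (polyL2 K p) = polyL2 K (MvPolynomial.pderiv i p) :=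
  (hasWeakDeriv_polyL2 K p i).wd_eq

theorem polyL2_mem_H2 (K : Polygon) (p : MvPolynomial (Fin 2) ℂ) :
    polyL2 K p ∈ H2 K.interior :=
  ⟨polyL2_mem_H1 K p, fun i => by rw [wd_polyL2]; exact polyL2_mem_H1 K _⟩

/-! ## Linearity of traces -/

theorem edge_mem_frontier (K : Polygon) (i : Fin (K.n + 3)) {t : ℝ} (ht : t ∈ Icc (0 : ℝ) 1) :
    K.edge i t ∈ frontier (K.interior : Set Plane) := by
  rw [K.frontier_eq]
  refine mem_iUnion.2 ⟨i, ?_⟩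
  rw [segment_eq_image_lineMap]
  exact ⟨t, ht, rfl⟩

theorem edge_continuous (K : Polygon) (i : Fin (K.n + 3)) : Continuous (K.edge i) :=
  AffineMap.lineMap_continuous

theorem tendsto_eLpNorm_add {α : Type*} [MeasurableSpace α] {μ : Measure α}
    {f g : ℕ → α → ℂ} {h : ℕ → α → ℂ} (hh : ∀ m, h m =ᵐ[μ] f m + g m)
    (hf : ∀ m, AEStronglyMeasurable (f m) μ) (hg : ∀ m, AEStronglyMeasurable (g m) μ)
    (hf0 : Tendsto (fun m => eLpNorm (f m) 2 μ) atTop (𝓝 0))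
    (hg0 : Tendsto (fun m => eLpNorm (g m) 2 μ) atTop (𝓝 0)) :
    Tendsto (fun m => eLpNorm (h m) 2 μ) atTop (𝓝 0) := by
  refine tendsto_of_tendsto_of_tendsto_of_le_of_le tendsto_const_nhds
    (by simpa using hf0.add hg0) (fun _ => zero_le) fun m => ?_
  rw [eLpNorm_congr_ae (hh m)]
  exact eLpNorm_add_le (hf m) (hg m) (by norm_num)

theorem tendsto_eLpNorm_smul {α : Type*} [MeasurableSpace α] {μ : Measure α} (c : ℂ)
    {f h : ℕ → α → ℂ} (hh : ∀ m, h m =ᵐ[μ] c • f m)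
    (hf0 : Tendsto (fun m => eLpNorm (f m) 2 μ) atTop (𝓝 0)) :
    Tendsto (fun m => eLpNorm (h m) 2 μ) atTop (𝓝 0) := by
  have : (fun m => eLpNorm (h m) 2 μ) = fun m => ‖c‖ₑ * eLpNorm (f m) 2 μ := by
    ext m
    rw [eLpNorm_congr_ae (hh m), eLpNorm_const_smul]
  rw [this]
  simpa using ENNReal.Tendsto.const_mul hf0 (Or.inr (by simp))

theorem IsTrace.add {K : Polygon} {f g : L2 K.interior} {τ σ : Plane → ℂ}
    (hf : IsTrace K f τ) (hg : IsTrace K g σ) : IsTrace K (f + g) (τ + σ) := by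
  obtain ⟨hf1, hfτ, φ, hφ, hφ0, hφ1, hφt⟩ := hf
  obtain ⟨hg1, hgσ, χ, hχ, hχ0, hχ1, hχt⟩ := hg
  have hd : ∀ {φ : ℕ → Plane → ℂ}, (∀ m, ContDiff ℝ ∞ (φ m)) → ∀ m i,
      Continuous fun x => fderiv ℝ (φ m) x (e i) := fun hφ m i =>
    ((hφ m).continuous_fderiv (by simp)).clm_apply continuous_const
  refine ⟨(H1 _).add_mem hf1 hg1, fun i => (hfτ i).add (hgσ i), fun m => φ m + χ m,
    fun m => (hφ m).add (hχ m), ?_, fun i => ?_, fun i => ?_⟩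
  · refine tendsto_eLpNorm_add (fun m => ?_) (fun m => ?_) (fun m => ?_) hφ0 hχ0
    · filter_upwards [Lp.coeFn_add f g] with x hx
      simp only [hx, Pi.add_apply]; ring
    · exact (hφ m).continuous.aestronglyMeasurable.sub (Lp.aestronglyMeasurable f)
    · exact (hχ m).continuous.aestronglyMeasurable.sub (Lp.aestronglyMeasurable g)
  · refine tendsto_eLpNorm_add (fun m => ?_) (fun m => ?_) (fun m => ?_) (hφ1 i) (hχ1 i)
    · filter_upwards [Lp.coeFn_add (wd K.interior i f) (wd K.interior i g)] with x hx
      rw [wd_add hf1 hg1]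
      simp only [hx, Pi.add_apply]
      rw [fderiv_add ((hφ m).differentiable (by simp) x) ((hχ m).differentiable (by simp) x)]
      simp only [add_apply]; ring
    · exact (hd hφ m i).aestronglyMeasurable.sub (Lp.aestronglyMeasurable _)
    · exact (hd hχ m i).aestronglyMeasurable.sub (Lp.aestronglyMeasurable _)
  · refine tendsto_eLpNorm_add (fun m => ?_) (fun m => ?_) (fun m => ?_) (hφt i) (hχt i)
    · refine Eventually.of_forall fun t => ?_
      simp only [Pi.add_apply]; ring
    · exact ((hφ m).continuous.comp (edge_continuous K i)).aestronglyMeasurable.sub (hfτ i).1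
    · exact ((hχ m).continuous.comp (edge_continuous K i)).aestronglyMeasurable.sub (hgσ i).1

theorem IsTrace.smul {K : Polygon} (c : ℂ) {f : L2 K.interior} {τ : Plane → ℂ}
    (hf : IsTrace K f τ) : IsTrace K (c • f) (c • τ) := by
  obtain ⟨hf1, hfτ, φ, hφ, hφ0, hφ1, hφt⟩ := hf
  refine ⟨(H1 _).smul_mem c hf1, fun i => (hfτ i).const_smul c, fun m => c • φ m,
    fun m => contDiff_const.smul (hφ m), ?_, fun i => ?_, fun i => ?_⟩
  · refine tendsto_eLpNorm_smul c (fun m => ?_) hφ0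
    filter_upwards [Lp.coeFn_smul c f] with x hx
    simp only [hx, Pi.smul_apply, smul_eq_mul]; ring
  · refine tendsto_eLpNorm_smul c (fun m => ?_) (hφ1 i)
    filter_upwards [Lp.coeFn_smul c (wd K.interior i f)] with x hx
    rw [wd_smul c hf1]
    simp only [hx, Pi.smul_apply, smul_eq_mul]
    rw [fderiv_const_smul ((hφ m).differentiable (by simp) x)]
    simp only [smul_apply, smul_eq_mul]; ring
  · refine tendsto_eLpNorm_smul c (fun m => ?_) (hφt i)
    refine Eventually.of_forall fun t => ?_
    simp only [Pi.smul_apply, smul_eq_mul]; ring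

theorem isTrace_polyL2 (K : Polygon) (p : MvPolynomial (Fin 2) ℂ) :
    IsTrace K (polyL2 K p) (polyFun p) := by
  refine ⟨polyL2_mem_H1 K p, fun i => ?_, fun _ => polyFun p, fun _ => polyFun_contDiff p,
    ?_, fun i => ?_, fun i => ?_⟩
  · have hc : Continuous fun t => polyFun p (K.edge i t) :=
      (polyFun_continuous p).comp (edge_continuous K i)
    obtain ⟨C, hC⟩ := (isCompact_Icc (a := (0 : ℝ)) (b := 1)).exists_bound_of_continuousOn
      hc.continuousOn
    exact MemLp.of_bound hc.aestronglyMeasurable C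
      ((ae_restrict_iff' measurableSet_Icc).2 (Eventually.of_forall hC))
  · refine tendsto_const_nhds.congr fun m => ?_
    symm
    rw [distL2, eLpNorm_congr_ae (g := fun _ => (0 : ℂ)), eLpNorm_zero']
    filter_upwards [polyL2_ae K p] with x hx
    rw [hx, sub_self]
  · refine tendsto_const_nhds.congr fun m => ?_
    symm
    rw [distL2, eLpNorm_congr_ae (g := fun _ => (0 : ℂ)), eLpNorm_zero']
    rw [wd_polyL2]
    filter_upwards [polyL2_ae K (MvPolynomial.pderiv i p)] with x hx
    rw [hx, fderiv_polyFun, sub_self]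
  · simp

theorem IsContTrace.add {K : Polygon} {f g : L2 K.interior} {τ σ : Plane → ℂ}
    (hf : IsContTrace K f τ) (hg : IsContTrace K g σ) : IsContTrace K (f + g) (τ + σ) :=
  ⟨hf.1.add hg.1, hf.2.add hg.2⟩

theorem IsContTrace.smul {K : Polygon} (c : ℂ) {f : L2 K.interior} {τ : Plane → ℂ}
    (hf : IsContTrace K f τ) : IsContTrace K (c • f) (c • τ) :=
  ⟨hf.1.smul c, hf.2.const_smul c⟩

theorem isContTrace_polyL2 (K : Polygon) (p : MvPolynomial (Fin 2) ℂ) :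
    IsContTrace K (polyL2 K p) (polyFun p) :=
  ⟨isTrace_polyL2 K p, (polyFun_continuous p).continuousOn⟩

theorem IsEdgePoly.add {K : Polygon} {k : ℕ} {i : Fin (K.n + 3)} {τ σ : Plane → ℂ}
    (h : IsEdgePoly K k i τ) (h' : IsEdgePoly K k i σ) : IsEdgePoly K k i (τ + σ) := by
  obtain ⟨q, hq, hτ⟩ := h
  obtain ⟨r, hr, hσ⟩ := h'
  exact ⟨q + r, Polynomial.natDegree_add_le_of_degree_le hq hr, fun t ht => by
    simp [hτ t ht, hσ t ht]⟩

theorem IsEdgePoly.smul {K : Polygon} {k : ℕ} {i : Fin (K.n + 3)} (c : ℂ) {τ : Plane → ℂ}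
    (h : IsEdgePoly K k i τ) : IsEdgePoly K k i (c • τ) := by
  obtain ⟨q, hq, hτ⟩ := h
  exact ⟨c • q, (Polynomial.natDegree_smul_le c q).trans hq, fun t ht => by simp [hτ t ht]⟩

theorem isEdgePoly_polyFun (K : Polygon) {k : ℕ} (i : Fin (K.n + 3))
    {p : MvPolynomial (Fin 2) ℂ} (hp : p ∈ P k) : IsEdgePoly K k i (polyFun p) := by
  rw [MvPolynomial.mem_restrictTotalDegree] at hp
  let c : Fin 2 → Polynomial ℂ := fun j =>
    Polynomial.C ((K.vertex i j : ℝ) : ℂ) +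
      Polynomial.X * Polynomial.C (((K.vertex (i + 1) j - K.vertex i j : ℝ)) : ℂ)
  have hc : ∀ j, (c j).natDegree ≤ 1 := fun j => by
    refine Polynomial.natDegree_add_le_of_degree_le (by simp) ?_
    exact Polynomial.natDegree_mul_le.trans (by simp)
  refine ⟨MvPolynomial.aeval c p, ?_, fun t _ => ?_⟩
  · rw [MvPolynomial.aeval_def, MvPolynomial.eval₂_eq]
    refine Polynomial.natDegree_sum_le_of_forall_le _ _ fun m hm => ?_
    refine (Polynomial.natDegree_C_mul_le _ _).trans ?_
    refine (Polynomial.natDegree_prod_le _ _).trans ?_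
    have h1 := (MvPolynomial.le_totalDegree hm).trans hp
    refine le_trans (Finset.sum_le_sum fun j _ => ?_) h1
    exact Polynomial.natDegree_pow_le.trans (by nlinarith [hc j])
  · have h1 : (MvPolynomial.aeval c p).eval (t : ℂ)
        = MvPolynomial.eval (fun j => (c j).eval (t : ℂ)) p := by
      have := MvPolynomial.comp_aeval_apply (f := c) (Polynomial.aeval (R := ℂ) (t : ℂ)) p
      rw [Polynomial.coe_aeval_eq_eval] at this
      rw [this, MvPolynomial.aeval_eq_eval]
    rw [h1, polyFun]
    congr 2
    ext j
    simp [c, Polygon.edge, AffineMap.lineMap_apply]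
    ring

/-! ## Laplacian and bilaplacian in the sense of distributions -/

/-- The Laplacian of a test function. -/
def lap {U : TopologicalSpace.Opens Plane} (φ : 𝓓(U, ℂ)) : 𝓓(U, ℂ) :=
  ∑ i, (∂_{e i} (∂_{e i} φ : 𝓓(U, ℂ)) : 𝓓(U, ℂ))

/-- `Δ f = p` on `U` in the sense of distributions. -/
def HasLaplacian (U : TopologicalSpace.Opens Plane) (f : L2 U) (p : MvPolynomial (Fin 2) ℂ) :
    Prop :=
  ∀ φ : 𝓓(U, ℂ), ∫ x in (U : Set Plane), f x * lap φ x = ∫ x in (U : Set Plane), polyFun p x * φ x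

/-- `Δ² f = p` on `U` in the sense of distributions. -/
def HasBilaplacian (U : TopologicalSpace.Opens Plane) (f : L2 U) (p : MvPolynomial (Fin 2) ℂ) :
    Prop :=
  ∀ φ : 𝓓(U, ℂ),
    ∫ x in (U : Set Plane), f x * lap (lap φ) x = ∫ x in (U : Set Plane), polyFun p x * φ x

theorem integral_add_polyFun_mul (K : Polygon) (p q : MvPolynomial (Fin 2) ℂ)
    (φ : 𝓓(K.interior, ℂ)) :
    ∫ x in (K.interior : Set Plane), polyFun (p + q) x * φ x
      = (∫ x in (K.interior : Set Plane), polyFun p x * φ x)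
        + ∫ x in (K.interior : Set Plane), polyFun q x * φ x := by
  rw [← integral_polyL2_mul, map_add, integral_add_mul (integrable_mul_test _ φ)
    (integrable_mul_test _ φ), integral_polyL2_mul, integral_polyL2_mul]

theorem integral_smul_polyFun_mul (K : Polygon) (c : ℂ) (p : MvPolynomial (Fin 2) ℂ)
    (h : Plane → ℂ) :
    ∫ x in (K.interior : Set Plane), polyFun (c • p) x * h x
      = c * ∫ x in (K.interior : Set Plane), polyFun p x * h x := by
  rw [← integral_polyL2_mul, map_smul, integral_smul_mul, integral_polyL2_mul]

theorem HasLaplacian.add {K : Polygon} {f g : L2 K.interior} {p q : MvPolynomial (Fin 2) ℂ}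
    (hf : HasLaplacian K.interior f p) (hg : HasLaplacian K.interior g q) :
    HasLaplacian K.interior (f + g) (p + q) := fun φ => by
  rw [integral_add_mul (integrable_mul_test _ _) (integrable_mul_test _ _), hf, hg,
    integral_add_polyFun_mul]

theorem HasLaplacian.smul {K : Polygon} (c : ℂ) {f : L2 K.interior}
    {p : MvPolynomial (Fin 2) ℂ} (hf : HasLaplacian K.interior f p) :
    HasLaplacian K.interior (c • f) (c • p) := fun φ => by
  rw [integral_smul_mul, hf, integral_smul_polyFun_mul]

theorem HasBilaplacian.add {K : Polygon} {f g : L2 K.interior} {p q : MvPolynomial (Fin 2) ℂ}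
    (hf : HasBilaplacian K.interior f p) (hg : HasBilaplacian K.interior g q) :
    HasBilaplacian K.interior (f + g) (p + q) := fun φ => by
  rw [integral_add_mul (integrable_mul_test _ _) (integrable_mul_test _ _), hf, hg,
    integral_add_polyFun_mul]

theorem HasBilaplacian.smul {K : Polygon} (c : ℂ) {f : L2 K.interior}
    {p : MvPolynomial (Fin 2) ℂ} (hf : HasBilaplacian K.interior f p) :
    HasBilaplacian K.interior (c • f) (c • p) := fun φ => by
  rw [integral_smul_mul, hf, integral_smul_polyFun_mul]

theorem hasLaplacian_polyL2 (K : Polygon) (p : MvPolynomial (Fin 2) ℂ) :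
    HasLaplacian K.interior (polyL2 K p)
      (∑ i, MvPolynomial.pderiv i (MvPolynomial.pderiv i p)) := fun φ => by
  have h1 : ∀ i, ∫ x in (K.interior : Set Plane), polyL2 K p x *
        (∂_{e i} (∂_{e i} φ : 𝓓(K.interior, ℂ)) : 𝓓(K.interior, ℂ)) x
      = ∫ x in (K.interior : Set Plane),
        polyFun (MvPolynomial.pderiv i (MvPolynomial.pderiv i p)) x * φ x := fun i => by
    rw [hasWeakDeriv_polyL2, hasWeakDeriv_polyL2, neg_neg, integral_polyL2_mul]
  rw [Fin.sum_univ_two, integral_add_polyFun_mul, ← h1, ← h1, ← integral_add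
    (integrable_mul_test _ _) (integrable_mul_test _ _)]
  refine integral_congr_ae (Eventually.of_forall fun x => ?_)
  simp only [lap, Fin.sum_univ_two, add_apply]
  ring

theorem lap_mem_P {k : ℕ} {p : MvPolynomial (Fin 2) ℂ} (hp : p ∈ P (k + 2)) :
    ∑ i, MvPolynomial.pderiv i (MvPolynomial.pderiv i p) ∈ P k :=
  Submodule.sum_mem _ fun i _ => pderiv_mem_P (pderiv_mem_P hp i) i

theorem hasBilaplacian_polyL2 (K : Polygon) {k : ℕ} {p : MvPolynomial (Fin 2) ℂ} (hp : p ∈ P k) :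
    ∃ q ∈ P k, HasBilaplacian K.interior (polyL2 K p) q := by
  refine ⟨_, lap_mem_P (lap_mem_P (P_mono (by omega : k ≤ k + 2 + 2) hp)), fun φ => ?_⟩
  rw [hasLaplacian_polyL2, ← integral_polyL2_mul, hasLaplacian_polyL2]

/-! ## The local forms -/

/-- `a_K^Δ(u, v) = ∫_K D²u : D²v̄`. -/
def aDelta (K : Polygon) (u v : L2 K.interior) : ℂ :=
  ∑ i, ∑ j, ∫ x in (K.interior : Set Plane),
    wd K.interior j (wd K.interior i u) x * conj (wd K.interior j (wd K.interior i v) x)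

/-- `a_K^∇(φ, ψ) = ∫_K ∇φ · ∇ψ̄`. -/
def aNabla (K : Polygon) (φ ψ : L2 K.interior) : ℂ :=
  ∑ i, ∫ x in (K.interior : Set Plane), wd K.interior i φ x * conj (wd K.interior i ψ x)

theorem integrable_mul_conj {U : TopologicalSpace.Opens Plane} (f g : L2 U) :
    Integrable (fun x => f x * conj (g x)) ((volume : Measure Plane).restrict (U : Set Plane)) :=
  (Lp.memLp f).integrable_mul (Lp.memLp g).star

theorem aDelta_add (K : Polygon) {u v : L2 K.interior} (hu : u ∈ H2 K.interior)
    (hv : v ∈ H2 K.interior) (w : L2 K.interior) :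
    aDelta K (u + v) w = aDelta K u w + aDelta K v w := by
  simp only [aDelta, ← Finset.sum_add_distrib]
  refine Finset.sum_congr rfl fun i _ => Finset.sum_congr rfl fun j _ => ?_
  rw [wd_add hu.1 hv.1, wd_add (hu.2 i) (hv.2 i),
    integral_add_mul (integrable_mul_conj _ _) (integrable_mul_conj _ _)]

theorem aDelta_smul (K : Polygon) (c : ℂ) {u : L2 K.interior} (hu : u ∈ H2 K.interior)
    (w : L2 K.interior) : aDelta K (c • u) w = c * aDelta K u w := by
  simp only [aDelta, Finset.mul_sum]
  refine Finset.sum_congr rfl fun i _ => Finset.sum_congr rfl fun j _ => ?_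
  rw [wd_smul c hu.1, wd_smul c (hu.2 i), integral_smul_mul]

theorem aNabla_add (K : Polygon) {u v : L2 K.interior} (hu : u ∈ H1 K.interior)
    (hv : v ∈ H1 K.interior) (w : L2 K.interior) :
    aNabla K (u + v) w = aNabla K u w + aNabla K v w := by
  simp only [aNabla, ← Finset.sum_add_distrib]
  refine Finset.sum_congr rfl fun i _ => ?_
  rw [wd_add hu hv, integral_add_mul (integrable_mul_conj _ _) (integrable_mul_conj _ _)]

theorem aNabla_smul (K : Polygon) (c : ℂ) {u : L2 K.interior} (hu : u ∈ H1 K.interior)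
    (w : L2 K.interior) : aNabla K (c • u) w = c * aNabla K u w := by
  simp only [aNabla, Finset.mul_sum]
  refine Finset.sum_congr rfl fun i _ => ?_
  rw [wd_smul c hu, integral_smul_mul]

/-! ## The preliminary local spaces -/

/-- The space `W̃_h^K`: functions in `H²(K)` with bilaplacian in `ℙ₂(K)`, continuous boundary values
that are cubic on each edge, and continuous boundary values of the gradient whose normal component
is affine on each edge. -/
def WTilde (K : Polygon) : Submodule ℂ (L2 K.interior) where
  carrier := {v | v ∈ H2 K.interior ∧
    (∃ p ∈ P 2, HasBilaplacian K.interior v p) ∧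
    (∃ τ, IsContTrace K v τ ∧ ∀ i, IsEdgePoly K 3 i τ) ∧
    ∃ γ : Fin 2 → Plane → ℂ, (∀ j, IsContTrace K (wd K.interior j v) (γ j)) ∧
      ∀ i, IsEdgePoly K 1 i
        (((K.normal i 0 : ℝ) : ℂ) • γ 0 + ((K.normal i 1 : ℝ) : ℂ) • γ 1)}
  zero_mem' := by
    refine ⟨(H2 _).zero_mem, ⟨0, (P 2).zero_mem, ?_⟩, ⟨polyFun 0, ?_, fun i =>
      isEdgePoly_polyFun K i (P 3).zero_mem⟩, fun _ => polyFun 0, fun j => ?_, fun i =>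
      (isEdgePoly_polyFun K i (P 1).zero_mem).smul _ |>.add
        ((isEdgePoly_polyFun K i (P 1).zero_mem).smul _)⟩
    · intro φ
      rw [← integral_polyL2_mul, map_zero]
      have h0 : ∀ h : Plane → ℂ, ∫ x in (K.interior : Set Plane), (0 : L2 K.interior) x * h x = 0 :=
        fun h => by simpa using integral_smul_mul 0 (0 : L2 K.interior) h
      rw [h0, h0]
    · simpa using isContTrace_polyL2 K 0
    · rw [wd_zero]; simpa using isContTrace_polyL2 K 0
  add_mem' := by
    rintro u v ⟨hu, ⟨p, hp, hup⟩, ⟨τ, hτ, hτe⟩, γ, hγ, hγe⟩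
      ⟨hv, ⟨q, hq, hvq⟩, ⟨σ, hσ, hσe⟩, δ, hδ, hδe⟩
    refine ⟨(H2 _).add_mem hu hv, ⟨p + q, (P 2).add_mem hp hq, hup.add hvq⟩,
      ⟨τ + σ, hτ.add hσ, fun i => (hτe i).add (hσe i)⟩, fun j => γ j + δ j, fun j => ?_,
      fun i => ?_⟩
    · rw [wd_add hu.1 hv.1]; exact (hγ j).add (hδ j)
    · have := (hγe i).add (hδe i)
      convert this using 1
      ext x
      simp only [Pi.add_apply, Pi.smul_apply, smul_eq_mul]; ring
  smul_mem' := by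
    rintro c u ⟨hu, ⟨p, hp, hup⟩, ⟨τ, hτ, hτe⟩, γ, hγ, hγe⟩
    refine ⟨(H2 _).smul_mem c hu, ⟨c • p, (P 2).smul_mem c hp, hup.smul c⟩,
      ⟨c • τ, hτ.smul c, fun i => (hτe i).smul c⟩, fun j => c • γ j, fun j => ?_,
      fun i => ?_⟩
    · rw [wd_smul c hu.1]; exact (hγ j).smul c
    · have := (hγe i).smul c
      convert this using 1
      ext x
      simp only [Pi.add_apply, Pi.smul_apply, smul_eq_mul]; ring

/-- The space `Ṽ_h^K`: functions in `H¹(K)` with Laplacian in `ℙ₁(K)` and continuous boundary values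
that are affine on each edge. -/
def VTilde (K : Polygon) : Submodule ℂ (L2 K.interior) where
  carrier := {ψ | ψ ∈ H1 K.interior ∧
    (∃ p ∈ P 1, HasLaplacian K.interior ψ p) ∧
    ∃ τ, IsContTrace K ψ τ ∧ ∀ i, IsEdgePoly K 1 i τ}
  zero_mem' := by
    refine ⟨(H1 _).zero_mem, ⟨0, (P 1).zero_mem, ?_⟩, polyFun 0, ?_, fun i =>
      isEdgePoly_polyFun K i (P 1).zero_mem⟩
    · simpa using hasLaplacian_polyL2 K 0
    · simpa using isContTrace_polyL2 K 0
  add_mem' := by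
    rintro u v ⟨hu, ⟨p, hp, hup⟩, τ, hτ, hτe⟩ ⟨hv, ⟨q, hq, hvq⟩, σ, hσ, hσe⟩
    exact ⟨(H1 _).add_mem hu hv, ⟨p + q, (P 1).add_mem hp hq, hup.add hvq⟩,
      τ + σ, hτ.add hσ, fun i => (hτe i).add (hσe i)⟩
  smul_mem' := by
    rintro c u ⟨hu, ⟨p, hp, hup⟩, τ, hτ, hτe⟩
    exact ⟨(H1 _).smul_mem c hu, ⟨c • p, (P 1).smul_mem c hp, hup.smul c⟩,
      c • τ, hτ.smul c, fun i => (hτe i).smul c⟩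

theorem polyL2_mem_WTilde (K : Polygon) {p : MvPolynomial (Fin 2) ℂ} (hp : p ∈ P 2) :
    polyL2 K p ∈ WTilde K := by
  refine ⟨polyL2_mem_H2 K p, hasBilaplacian_polyL2 K hp, ⟨polyFun p, isContTrace_polyL2 K p,
    fun i => isEdgePoly_polyFun K i (P_mono (by omega) hp)⟩,
    fun j => polyFun (MvPolynomial.pderiv j p), fun j => ?_, fun i => ?_⟩
  · rw [wd_polyL2]; exact isContTrace_polyL2 K _
  · exact ((isEdgePoly_polyFun K i (pderiv_mem_P hp 0)).smul _).add
      ((isEdgePoly_polyFun K i (pderiv_mem_P hp 1)).smul _)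

theorem polyL2_mem_VTilde (K : Polygon) {p : MvPolynomial (Fin 2) ℂ} (hp : p ∈ P 1) :
    polyL2 K p ∈ VTilde K :=
  ⟨polyL2_mem_H1 K p, ⟨_, lap_mem_P (P_mono (by omega) hp), hasLaplacian_polyL2 K p⟩,
    polyFun p, isContTrace_polyL2 K p, fun i => isEdgePoly_polyFun K i hp⟩

/-! ## The projectors and the local virtual element spaces -/

/-- `p = Π₂^Δ v`: `p ∈ ℙ₂(K)`, `a_K^Δ(p, q) = a_K^Δ(v, q)` for `q ∈ ℙ₂(K)` and
`((p, q))_K = ((v, q))_K` for `q ∈ ℙ₁(K)`, where `((u, v))_K` is the sum of `u v` over the vertices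
of `K`; the vertex values of `v` are those of its continuous boundary values. -/
def IsProjDelta (K : Polygon) (v : L2 K.interior) (p : MvPolynomial (Fin 2) ℂ) : Prop :=
  p ∈ P 2 ∧
  (∀ q ∈ P 2, aDelta K (polyL2 K p) (polyL2 K q) = aDelta K v (polyL2 K q)) ∧
  ∃ τ, IsContTrace K v τ ∧ ∀ q ∈ P 1,
    ∑ i, polyFun p (K.vertex i) * polyFun q (K.vertex i)
      = ∑ i, τ (K.vertex i) * polyFun q (K.vertex i)

/-- `p = Π₁^∇ ψ`: `p ∈ ℙ₁(K)`, `a_K^∇(p, q) = a_K^∇(ψ, q)` for `q ∈ ℙ₁(K)` and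
`(p, 1)_{∂K} = (ψ, 1)_{∂K}`. -/
def IsProjNabla (K : Polygon) (ψ : L2 K.interior) (p : MvPolynomial (Fin 2) ℂ) : Prop :=
  p ∈ P 1 ∧
  (∀ q ∈ P 1, aNabla K (polyL2 K p) (polyL2 K q) = aNabla K ψ (polyL2 K q)) ∧
  ∃ τ, IsTrace K ψ τ ∧ bdryIntegral K (polyFun p) = bdryIntegral K τ

open Classical in
/-- The projector `Π₂^Δ`. -/
def projDelta (K : Polygon) (v : L2 K.interior) : MvPolynomial (Fin 2) ℂ :=
  if h : ∃ p, IsProjDelta K v p then h.choose else 0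

open Classical in
/-- The projector `Π₁^∇`. -/
def projNabla (K : Polygon) (ψ : L2 K.interior) : MvPolynomial (Fin 2) ℂ :=
  if h : ∃ p, IsProjNabla K ψ p then h.choose else 0

theorem IsProjDelta.add {K : Polygon} {u v : L2 K.interior} {p q : MvPolynomial (Fin 2) ℂ}
    (hu : u ∈ H2 K.interior) (hv : v ∈ H2 K.interior) (hp : IsProjDelta K u p)
    (hq : IsProjDelta K v q) : IsProjDelta K (u + v) (p + q) := by
  obtain ⟨hp, hpa, τ, hτ, hpτ⟩ := hp
  obtain ⟨hq, hqa, σ, hσ, hqσ⟩ := hq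
  refine ⟨(P 2).add_mem hp hq, fun r hr => ?_, τ + σ, hτ.add hσ, fun r hr => ?_⟩
  · rw [map_add, aDelta_add K (polyL2_mem_H2 K p) (polyL2_mem_H2 K q), aDelta_add K hu hv,
      hpa r hr, hqa r hr]
  · have := congrArg₂ (· + ·) (hpτ r hr) (hqσ r hr)
    simp only [← Finset.sum_add_distrib] at this
    simpa only [polyFun, map_add, add_mul, Pi.add_apply] using this

theorem IsProjDelta.smul {K : Polygon} (c : ℂ) {u : L2 K.interior}
    {p : MvPolynomial (Fin 2) ℂ} (hu : u ∈ H2 K.interior) (hp : IsProjDelta K u p) :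
    IsProjDelta K (c • u) (c • p) := by
  obtain ⟨hp, hpa, τ, hτ, hpτ⟩ := hp
  refine ⟨(P 2).smul_mem c hp, fun r hr => ?_, c • τ, hτ.smul c, fun r hr => ?_⟩
  · rw [map_smul, aDelta_smul K c (polyL2_mem_H2 K p), aDelta_smul K c hu, hpa r hr]
  · have := congrArg (c * ·) (hpτ r hr)
    simp only [Finset.mul_sum] at this
    simpa only [polyFun, MvPolynomial.smul_eval, Pi.smul_apply, smul_eq_mul, mul_assoc] using this

theorem isProjDelta_polyL2 (K : Polygon) {p : MvPolynomial (Fin 2) ℂ} (hp : p ∈ P 2) :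
    IsProjDelta K (polyL2 K p) p :=
  ⟨hp, fun _ _ => rfl, polyFun p, isContTrace_polyL2 K p, fun _ _ => rfl⟩

theorem IsTrace.intervalIntegrable {K : Polygon} {f : L2 K.interior} {τ : Plane → ℂ}
    (h : IsTrace K f τ) (i : Fin (K.n + 3)) :
    IntervalIntegrable (fun t => τ (K.edge i t)) volume 0 1 := by
  rw [intervalIntegrable_iff_integrableOn_Icc_of_le zero_le_one]
  exact (h.2.1 i).integrable (by norm_num)

theorem bdryIntegral_add {K : Polygon} {f g : L2 K.interior} {τ σ : Plane → ℂ}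
    (hf : IsTrace K f τ) (hg : IsTrace K g σ) :
    bdryIntegral K (τ + σ) = bdryIntegral K τ + bdryIntegral K σ := by
  simp only [bdryIntegral, ← Finset.sum_add_distrib, ← mul_add]
  refine Finset.sum_congr rfl fun i _ => ?_
  rw [← intervalIntegral.integral_add (hf.intervalIntegrable i) (hg.intervalIntegrable i)]
  rfl

theorem bdryIntegral_smul (K : Polygon) (c : ℂ) (τ : Plane → ℂ) :
    bdryIntegral K (c • τ) = c * bdryIntegral K τ := by
  simp only [bdryIntegral, Finset.mul_sum]
  refine Finset.sum_congr rfl fun i _ => ?_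
  simp only [Pi.smul_apply, smul_eq_mul, intervalIntegral.integral_const_mul]
  ring

theorem IsProjNabla.add {K : Polygon} {u v : L2 K.interior} {p q : MvPolynomial (Fin 2) ℂ}
    (hu : u ∈ H1 K.interior) (hv : v ∈ H1 K.interior) (hp : IsProjNabla K u p)
    (hq : IsProjNabla K v q) : IsProjNabla K (u + v) (p + q) := by
  obtain ⟨hp, hpa, τ, hτ, hpτ⟩ := hp
  obtain ⟨hq, hqa, σ, hσ, hqσ⟩ := hq
  refine ⟨(P 1).add_mem hp hq, fun r hr => ?_, τ + σ, hτ.add hσ, ?_⟩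
  · rw [map_add, aNabla_add K (polyL2_mem_H1 K p) (polyL2_mem_H1 K q), aNabla_add K hu hv,
      hpa r hr, hqa r hr]
  · rw [bdryIntegral_add hτ hσ, ← hpτ, ← hqσ,
      ← bdryIntegral_add (isTrace_polyL2 K p) (isTrace_polyL2 K q)]
    congr 1
    ext x
    simp [polyFun]

theorem IsProjNabla.smul {K : Polygon} (c : ℂ) {u : L2 K.interior}
    {p : MvPolynomial (Fin 2) ℂ} (hu : u ∈ H1 K.interior) (hp : IsProjNabla K u p) :
    IsProjNabla K (c • u) (c • p) := by
  obtain ⟨hp, hpa, τ, hτ, hpτ⟩ := hp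
  refine ⟨(P 1).smul_mem c hp, fun r hr => ?_, c • τ, hτ.smul c, ?_⟩
  · rw [map_smul, aNabla_smul K c (polyL2_mem_H1 K p), aNabla_smul K c hu, hpa r hr]
  · rw [bdryIntegral_smul, ← hpτ, ← bdryIntegral_smul]
    congr 1
    ext x
    simp [polyFun, MvPolynomial.smul_eval]

theorem isProjNabla_polyL2 (K : Polygon) {p : MvPolynomial (Fin 2) ℂ} (hp : p ∈ P 1) :
    IsProjNabla K (polyL2 K p) p :=
  ⟨hp, fun _ _ => rfl, polyFun p, isTrace_polyL2 K p, rfl⟩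

theorem integrable_mul_polyFun {K : Polygon} (f : L2 K.interior)
    (q : MvPolynomial (Fin 2) ℂ) : Integrable (fun x => f x * polyFun q x)
      ((volume : Measure Plane).restrict (K.interior : Set Plane)) :=
  (Lp.memLp f).integrable_mul (polyFun_memLp K q)

theorem integral_add_polyFun_mul_polyFun (K : Polygon) (p q r : MvPolynomial (Fin 2) ℂ) :
    ∫ x in (K.interior : Set Plane), polyFun (p + q) x * polyFun r x
      = (∫ x in (K.interior : Set Plane), polyFun p x * polyFun r x)
        + ∫ x in (K.interior : Set Plane), polyFun q x * polyFun r x := by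
  rw [← integral_polyL2_mul, map_add, integral_add_mul (integrable_mul_polyFun _ r)
    (integrable_mul_polyFun _ r), integral_polyL2_mul, integral_polyL2_mul]

/-- The local virtual space `W_h^K`: those `v ∈ W̃_h^K` with `∫_K (Π₂^Δ v) q = ∫_K v q` for all
`q ∈ ℙ₂(K)`. -/
def WLoc (K : Polygon) : Submodule ℂ (L2 K.interior) where
  carrier := {v | v ∈ WTilde K ∧ ∃ p, IsProjDelta K v p ∧ ∀ q ∈ P 2,
    ∫ x in (K.interior : Set Plane), polyFun p x * polyFun q x
      = ∫ x in (K.interior : Set Plane), v x * polyFun q x}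
  zero_mem' := by
    refine ⟨(WTilde K).zero_mem, 0, ?_, fun q _ => ?_⟩
    · simpa using isProjDelta_polyL2 K (P 2).zero_mem
    · rw [← integral_polyL2_mul, map_zero]
  add_mem' := by
    rintro u v ⟨hu, p, hp, hup⟩ ⟨hv, q, hq, hvq⟩
    refine ⟨(WTilde K).add_mem hu hv, p + q, hp.add hu.1 hv.1 hq, fun r hr => ?_⟩
    rw [integral_add_polyFun_mul_polyFun, hup r hr, hvq r hr,
      integral_add_mul (integrable_mul_polyFun _ r) (integrable_mul_polyFun _ r)]
  smul_mem' := by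
    rintro c u ⟨hu, p, hp, hup⟩
    refine ⟨(WTilde K).smul_mem c hu, c • p, hp.smul c hu.1, fun r hr => ?_⟩
    rw [integral_smul_polyFun_mul, hup r hr, integral_smul_mul]

/-- The local virtual space `V_h^K`: those `ψ ∈ Ṽ_h^K` with `∫_K (Π₁^∇ ψ) q = ∫_K ψ q` for all
`q ∈ ℙ₁(K)`. -/
def VLoc (K : Polygon) : Submodule ℂ (L2 K.interior) where
  carrier := {ψ | ψ ∈ VTilde K ∧ ∃ p, IsProjNabla K ψ p ∧ ∀ q ∈ P 1,
    ∫ x in (K.interior : Set Plane), polyFun p x * polyFun q x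
      = ∫ x in (K.interior : Set Plane), ψ x * polyFun q x}
  zero_mem' := by
    refine ⟨(VTilde K).zero_mem, 0, ?_, fun q _ => ?_⟩
    · simpa using isProjNabla_polyL2 K (P 1).zero_mem
    · rw [← integral_polyL2_mul, map_zero]
  add_mem' := by
    rintro u v ⟨hu, p, hp, hup⟩ ⟨hv, q, hq, hvq⟩
    refine ⟨(VTilde K).add_mem hu hv, p + q, hp.add hu.1 hv.1 hq, fun r hr => ?_⟩
    rw [integral_add_polyFun_mul_polyFun, hup r hr, hvq r hr,
      integral_add_mul (integrable_mul_polyFun _ r) (integrable_mul_polyFun _ r)]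
  smul_mem' := by
    rintro c u ⟨hu, p, hp, hup⟩
    refine ⟨(VTilde K).smul_mem c hu, c • p, hp.smul c hu.1, fun r hr => ?_⟩
    rw [integral_smul_polyFun_mul, hup r hr, integral_smul_mul]

theorem polyL2_mem_WLoc (K : Polygon) {p : MvPolynomial (Fin 2) ℂ} (hp : p ∈ P 2) :
    polyL2 K p ∈ WLoc K :=
  ⟨polyL2_mem_WTilde K hp, p, isProjDelta_polyL2 K hp, fun _ _ =>
    (integral_polyL2_mul K p _).symm⟩

theorem polyL2_mem_VLoc (K : Polygon) {p : MvPolynomial (Fin 2) ℂ} (hp : p ∈ P 1) :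
    polyL2 K p ∈ VLoc K :=
  ⟨polyL2_mem_VTilde K hp, p, isProjNabla_polyL2 K hp, fun _ _ =>
    (integral_polyL2_mul K p _).symm⟩

theorem projDelta_mem (K : Polygon) (v : L2 K.interior) : projDelta K v ∈ P 2 := by
  unfold projDelta
  split_ifs with h
  · exact h.choose_spec.1
  · exact (P 2).zero_mem

theorem projNabla_mem (K : Polygon) (ψ : L2 K.interior) : projNabla K ψ ∈ P 1 := by
  unfold projNabla
  split_ifs with h
  · exact h.choose_spec.1
  · exact (P 1).zero_mem

/-- `Π₂^Δ v` as an element of `W_h^K`. -/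
def projW (K : Polygon) (v : WLoc K) : WLoc K :=
  ⟨polyL2 K (projDelta K v), polyL2_mem_WLoc K (projDelta_mem K v)⟩

/-- `Π₁^∇ ψ` as an element of `V_h^K`. -/
def projV (K : Polygon) (ψ : VLoc K) : VLoc K :=
  ⟨polyL2 K (projNabla K ψ), polyL2_mem_VLoc K (projNabla_mem K ψ)⟩

/-! ## The discrete forms -/

/-- A symmetric (Hermitian) positive definite sesquilinear form. -/
def IsSPD {W : Type*} [AddCommGroup W] [Module ℂ W] (s : W →ₗ[ℂ] W →ₗ⋆[ℂ] ℂ) : Prop :=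
  (∀ u v, s u v = conj (s v u)) ∧ ∀ u, u ≠ 0 → 0 < (s u u).re

/-- An admissible stabilization `s_K^Δ`: symmetric positive definite on `W_h^K` and, with the
constants `c₀`, `c₁`, comparable to `a_K^Δ` on the functions with `Π₂^Δ v = 0`. -/
def IsStabDelta (K : Polygon) (s : WLoc K →ₗ[ℂ] WLoc K →ₗ⋆[ℂ] ℂ) (c₀ c₁ : ℝ) : Prop :=
  IsSPD s ∧ ∀ v : WLoc K, IsProjDelta K v 0 →
    c₀ * (aDelta K v v).re ≤ (s v v).re ∧ (s v v).re ≤ c₁ * (aDelta K v v).re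

/-- An admissible stabilization `s_K^∇`: symmetric positive definite on `V_h^K` and, with the
constants `c₂`, `c₃`, comparable to `a_K^∇` on the functions with `Π₁^∇ ψ = 0`. -/
def IsStabNabla (K : Polygon) (s : VLoc K →ₗ[ℂ] VLoc K →ₗ⋆[ℂ] ℂ) (c₂ c₃ : ℝ) : Prop :=
  IsSPD s ∧ ∀ ψ : VLoc K, IsProjNabla K ψ 0 →
    c₂ * (aNabla K ψ ψ).re ≤ (s ψ ψ).re ∧ (s ψ ψ).re ≤ c₃ * (aNabla K ψ ψ).re

/-- The local discrete form `a_{h,K}^Δ`. -/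
def aDeltaH (K : Polygon) (s : WLoc K →ₗ[ℂ] WLoc K →ₗ⋆[ℂ] ℂ) (u v : WLoc K) : ℂ :=
  aDelta K (projW K u) (projW K v) + s (u - projW K u) (v - projW K v)

/-- The local discrete form `a_{h,K}^∇`. -/
def aNablaH (K : Polygon) (s : VLoc K →ₗ[ℂ] VLoc K →ₗ⋆[ℂ] ℂ) (φ ψ : VLoc K) : ℂ :=
  aNabla K (projV K φ) (projV K ψ) + s (φ - projV K φ) (ψ - projV K ψ)

variable {Ω : TopologicalSpace.Opens Plane}

/-- The global virtual space `W_h`. -/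
def WGlob (T : Mesh Ω) : Set (L2 Ω) :=
  {v | v ∈ H20 Ω ∧ ∀ k, restr (T.le k) v ∈ WLoc (T.elem k)}

/-- The global virtual space `V_h`. -/
def VGlob (T : Mesh Ω) : Set (L2 Ω) :=
  {ψ | ψ ∈ H10 Ω ∧ ∀ k, restr (T.le k) ψ ∈ VLoc (T.elem k)}

/-- The restriction of `v ∈ W_h` to an element. -/
def restrW (T : Mesh Ω) (k : Fin T.card) (v : WGlob T) : WLoc (T.elem k) :=
  ⟨restr (T.le k) v, v.2.2 k⟩

/-- The restriction of `ψ ∈ V_h` to an element. -/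
def restrV (T : Mesh Ω) (k : Fin T.card) (ψ : VGlob T) : VLoc (T.elem k) :=
  ⟨restr (T.le k) ψ, ψ.2.2 k⟩

/-- The discrete space `Z_h = W_h × V_h`. -/
abbrev Z (T : Mesh Ω) : Type := WGlob T × VGlob T

/-- The discrete sesquilinear form `a_h` on `Z_h`, for given stabilizations. -/
def aH (T : Mesh Ω)
    (sΔ : ∀ k, WLoc (T.elem k) →ₗ[ℂ] WLoc (T.elem k) →ₗ⋆[ℂ] ℂ)
    (sN : ∀ k, VLoc (T.elem k) →ₗ[ℂ] VLoc (T.elem k) →ₗ⋆[ℂ] ℂ) (x y : Z T) : ℂ :=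
  ∑ k, (aDeltaH (T.elem k) (sΔ k) (restrW T k x.1) (restrW T k y.1)
    + aNablaH (T.elem k) (sN k) (restrV T k x.2) (restrV T k y.2))

end

end VEM

/-! The top-order seminorms carry the whole estimate. On `H20` and `H10` Poincaré's inequality
bounds the full norms by the sums of squares of the second and first derivatives respectively, with
a factor `M` that is fixed by the bounded domain before any mesh appears (`exists_seminorm_bound`).
It is therefore enough to bound these seminorms by the discrete form.

This is done element by element. Split a local function as v = Πv + (v - Πv). By the triangle
inequality, a_K(v,v) ≤ 2 (a_K(Πv,Πv) + a_K(v - Πv, v - Πv)). The first term occurs in the discrete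
form with coefficient 1. The error v - Πv is annihilated by Π, so the stabilization dominates the
second term up to the factor c₀ or c₂. With m = min(1, c₀, c₂) this gives (m/2) a_K(v,v) ≤
a_{h,K}(v,v), in `IsStabDelta.le_aDeltaH` and `IsStabNabla.le_aNablaH`. The a_K-orthogonality of Πv
and v - Πv would save the factor 1/2, but it is not needed.

The local seminorms add up to the global ones because weak derivatives commute with restriction
(`wd_restr`) and the elements fill the domain up to a null set (`Mesh.sum_norm_restr_sq`). Hence β =
m / (2M). Realness follows from the Hermitian symmetry of the stabilizations and from a_K(v,v) being
a sum of squared norms. -/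

namespace VEM

/-! ## Restriction to a smaller open set -/

section restriction

variable {U V : TopologicalSpace.Opens Plane}

/-- Extension by zero of a test function to a larger open set. -/
noncomputable def extendTest (h : V ≤ U) (φ : 𝓓(V, ℂ)) : 𝓓(U, ℂ) where
  toFun := φ
  contDiff' := φ.contDiff
  hasCompactSupport' := φ.hasCompactSupport
  tsupport_subset' := φ.tsupport_subset.trans h

theorem lineDerivOp_test_apply (φ : 𝓓(U, ℂ)) (i : Fin 2) (x : Plane) :
    (∂_{e i} φ : 𝓓(U, ℂ)) x = fderiv ℝ φ x (e i) := by
  have hφd : Differentiable ℝ (φ : Plane → ℂ) := φ.contDiff.differentiable (by simp)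
  rw [TestFunction.lineDerivOp_eq_lineDerivCLM ℝ, TestFunction.lineDerivCLM_apply,
    if_pos (by simp), (hφd x).lineDeriv_eq_fderiv]

theorem restr_ae (h : V ≤ U) (f : L2 U) :
    restr h f =ᵐ[(volume : Measure Plane).restrict (V : Set Plane)] f :=
  MemLp.coeFn_toLp _

theorem integral_restr_mul_test (h : V ≤ U) (f : L2 U) (φ : 𝓓(V, ℂ)) :
    ∫ x in (V : Set Plane), restr h f x * φ x = ∫ x in (U : Set Plane), f x * φ x := by
  have h1 : ∫ x in (V : Set Plane), restr h f x * φ x = ∫ x in (V : Set Plane), f x * φ x := by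
    refine integral_congr_ae ?_
    filter_upwards [restr_ae h f] with x hx
    rw [hx]
  rw [h1]
  refine (setIntegral_eq_of_subset_of_forall_sdiff_eq_zero U.isOpen.measurableSet h
    fun x hx => ?_).symm
  rw [image_eq_zero_of_notMem_tsupport fun hx' => hx.2 (φ.tsupport_subset hx'), mul_zero]

/-- A test function on the smaller set, extended by zero, is one on the larger set, so the defining
identity there specializes. -/
theorem HasWeakDeriv.restr (h : V ≤ U) {i : Fin 2} {f g : L2 U} (hf : HasWeakDeriv U i f g) :
    HasWeakDeriv V i (restr h f) (restr h g) := by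
  intro φ
  rw [integral_restr_mul_test, integral_restr_mul_test]
  have := hf (extendTest h φ)
  simp only [lineDerivOp_test_apply] at this ⊢
  exact this

theorem wd_restr (h : V ≤ U) {f : L2 U} (hf : f ∈ H1 U) (i : Fin 2) :
    wd V i (restr h f) = restr h (wd U i f) :=
  ((hasWeakDeriv_wd hf i).restr h).wd_eq

/-! ### Squared L² norms as integrals. -/

theorem norm_sq_eq_integral (f : L2 U) :
    ‖f‖ ^ 2 = ∫ x in (U : Set Plane), ‖f x‖ ^ 2 := by
  have h : ((‖f‖ ^ 2 : ℝ) : ℂ) = ((∫ x in (U : Set Plane), ‖f x‖ ^ 2 : ℝ) : ℂ) := by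
    rw [← integral_complex_ofReal]
    push_cast
    have := inner_self_eq_norm_sq_to_K (𝕜 := ℂ) f
    rw [L2.inner_def] at this
    simp only [inner_self_eq_norm_sq_to_K] at this
    exact this.symm
  exact_mod_cast h

theorem integrable_norm_sq (f : L2 U) :
    Integrable (fun x => ‖f x‖ ^ 2) ((volume : Measure Plane).restrict (U : Set Plane)) :=
  (Lp.memLp f).integrable_norm_pow (by norm_num)

theorem norm_restr_sq (h : V ≤ U) (f : L2 U) :
    ‖restr h f‖ ^ 2 = ∫ x in (V : Set Plane), ‖f x‖ ^ 2 := by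
  rw [norm_sq_eq_integral]
  refine integral_congr_ae ?_
  filter_upwards [restr_ae h f] with x hx
  rw [hx]

end restriction

/-! ## The elements of a mesh cover the domain up to a null set -/

/-- The affine span of two points has dimension at most one, so it is a proper affine subspace of
the plane and has measure zero. -/
theorem volume_segment (a b : Plane) : volume (segment ℝ a b) = 0 := by
  refine measure_mono_null ?_
    (Measure.addHaar_affineSubspace volume (affineSpan ℝ ({a, b} : Set Plane)) fun h => ?_)
  · rw [← convexHull_pair]
    exact convexHull_subset_affineSpan _
  · have h1 := collinear_iff_finrank_le_one.1 (collinear_pair ℝ a b)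
    rw [← direction_affineSpan, h, AffineSubspace.direction_top, finrank_top,
      finrank_euclideanSpace_fin] at h1
    omega

theorem Polygon.volume_frontier (K : Polygon) :
    volume (frontier (K.interior : Set Plane)) = 0 := by
  rw [K.frontier_eq]
  exact measure_iUnion_null fun i => volume_segment _ _

namespace Mesh

variable {Ω : TopologicalSpace.Opens Plane} (T : Mesh Ω)

theorem ae_eq_iUnion :
    (⋃ k, ((T.elem k).interior : Set Plane)) =ᵐ[(volume : Measure Plane)] (Ω : Set Plane) := by
  refine (LE.le.eventuallyLE (iUnion_subset T.le)).antisymm ?_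
  rw [ae_le_set]
  -- A point of the domain outside every element still lies in the closure of one of them, hence on
  -- its boundary, which is a finite union of segments.
  refine measure_mono_null (fun x hx => ?_)
    (measure_iUnion_null fun k => (T.elem k).volume_frontier)
  have hx' : x ∈ closure (Ω : Set Plane) := subset_closure hx.1
  rw [T.cover] at hx'
  obtain ⟨k, hk⟩ := mem_iUnion.1 hx'
  refine mem_iUnion.2 ⟨k, hk, fun hi => hx.2 (mem_iUnion.2 ⟨k, interior_subset hi⟩)⟩

/-- Additivity of the integral over the disjoint elements. Applied to weak derivatives, this turns
local seminorms into global ones. -/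
theorem sum_norm_restr_sq (f : L2 Ω) : ∑ k, ‖restr (T.le k) f‖ ^ 2 = ‖f‖ ^ 2 := by
  rw [norm_sq_eq_integral, ← setIntegral_congr_set T.ae_eq_iUnion, integral_iUnion_fintype
    (fun k => (T.elem k).interior.isOpen.measurableSet) (fun k l h => ?_)
    (fun k => (integrable_norm_sq f).mono_measure (Measure.restrict_mono (T.le k) le_rfl))]
  · exact Finset.sum_congr rfl fun k _ => norm_restr_sq _ _
  · have := (T.disjoint k l h).le_bot
    rw [Function.onFun, Set.disjoint_iff]
    exact this

end Mesh

/-! ## Poincaré inequalities -/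

section poincare

variable {U : TopologicalSpace.Opens Plane}

theorem norm_clm_le_sum (A : Plane →L[ℝ] ℂ) : ‖A‖ ≤ ∑ i, ‖A (e i)‖ := by
  refine A.opNorm_le_bound (Finset.sum_nonneg fun i _ => norm_nonneg _) fun x => ?_
  have hx : x = ∑ i, x i • e i := by
    ext j
    fin_cases j <;> simp [e]
  conv_lhs => rw [hx]
  rw [map_sum, Finset.sum_mul]
  refine (norm_sum_le _ _).trans (Finset.sum_le_sum fun i _ => ?_)
  rw [map_smul, norm_smul, mul_comm]
  exact mul_le_mul_of_nonneg_left (PiLp.norm_apply_le x i) (norm_nonneg _)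

/-- The Gagliardo–Nirenberg–Sobolev inequality bounds the L² norm of a test function by the L¹ norm
of its gradient; Hölder's inequality on the bounded set then passes to the L² norm of the gradient.
The constant is the product of the two factors. -/
theorem poincare_test (hU : Bornology.IsBounded (U : Set Plane)) :
    ∃ C : ℝ≥0∞, C ≠ ⊤ ∧ ∀ φ : 𝓓(U, ℂ),
      eLpNorm φ 2 (volume.restrict (U : Set Plane))
        ≤ C * ∑ i, eLpNorm (∂_{e i} φ : 𝓓(U, ℂ)) 2 (volume.restrict (U : Set Plane)) := by
  refine ⟨eLpNormLESNormFDerivOfLeConst ℂ (volume : Measure Plane) (U : Set Plane) 1 2 *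
    volume (U : Set Plane) ^ (1 / (1 : ℝ≥0∞).toReal - 1 / (2 : ℝ≥0∞).toReal),
    ENNReal.mul_ne_top ENNReal.coe_ne_top
      (ENNReal.rpow_ne_top_of_nonneg (by norm_num) hU.measure_lt_top.ne), fun φ => ?_⟩
  have hc : Continuous fun x => fderiv ℝ φ x := φ.contDiff.continuous_fderiv (by simp)
  have hsupp : Function.support (φ : Plane → ℂ) ⊆ U :=
    (subset_tsupport _).trans φ.tsupport_subset
  have hsupp' : Function.support (fderiv ℝ (φ : Plane → ℂ)) ⊆ U :=
    (support_fderiv_subset ℝ).trans φ.tsupport_subset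
  -- In dimension 2 the exponent of the gradient must be below 2; `p = 1` is exactly critical for `q
  -- = 2`, since 1/1 - 1/2 = 1/2.
  have h1 := eLpNorm_le_eLpNorm_fderiv_of_le (volume : Measure Plane) (u := (φ : Plane → ℂ))
    (s := (U : Set Plane)) (p := 1) (q := 2) (φ.contDiff.of_le (by simp)) hsupp le_rfl
    (by rw [finrank_euclideanSpace_fin]; norm_num) (by rw [finrank_euclideanSpace_fin]; norm_num)
    hU
  rw [← eLpNorm_restrict_eq_of_support_subset hsupp,
    ← eLpNorm_restrict_eq_of_support_subset (f := fderiv ℝ (φ : Plane → ℂ)) hsupp'] at h1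
  refine h1.trans ?_
  rw [mul_assoc]
  gcongr
  -- Hölder's inequality, from L¹ to L², at the cost of a power of the measure of `U`.
  refine (eLpNorm_le_eLpNorm_mul_rpow_measure_univ (q := 2) (by norm_num)
    hc.aestronglyMeasurable).trans ?_
  rw [Measure.restrict_apply_univ, mul_comm]
  simp only [ENNReal.coe_one]
  gcongr
  calc eLpNorm (fderiv ℝ φ) 2 (volume.restrict (U : Set Plane))
      ≤ eLpNorm (∑ i, fun x => ‖(∂_{e i} φ : 𝓓(U, ℂ)) x‖) 2 (volume.restrict (U : Set Plane)) := by
        refine eLpNorm_mono_real fun x => ?_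
        simp only [Finset.sum_apply, lineDerivOp_test_apply]
        exact norm_clm_le_sum _
    _ ≤ ∑ i, eLpNorm (fun x => ‖(∂_{e i} φ : 𝓓(U, ℂ)) x‖) 2 (volume.restrict (U : Set Plane)) :=
        eLpNorm_sum_le (fun i _ =>
          (∂_{e i} φ : 𝓓(U, ℂ)).continuous.norm.aestronglyMeasurable) (by norm_num)
    _ = _ := by simp only [eLpNorm_norm]

/-! ### From test functions to their closures in H¹ and H². -/

theorem eLpNorm_le_add_distL2 {f g : Plane → ℂ}
    (hf : AEStronglyMeasurable f (volume.restrict (U : Set Plane)))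
    (hg : AEStronglyMeasurable g (volume.restrict (U : Set Plane))) :
    eLpNorm f 2 (volume.restrict (U : Set Plane))
      ≤ eLpNorm g 2 (volume.restrict (U : Set Plane)) + distL2 U f g := by
  have h := eLpNorm_add_le hg (hf.sub hg) (p := 2) (by norm_num)
  rwa [add_sub_cancel] at h

theorem distL2_comm (f g : Plane → ℂ) : distL2 U f g = distL2 U g f :=
  eLpNorm_sub_comm f g 2 _

/-- Both sides of the inequality for test functions are continuous in the H¹ norm, so it survives
the closure. -/
theorem poincare_H10 (hU : Bornology.IsBounded (U : Set Plane)) :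
    ∃ C : ℝ, ∀ f ∈ H10 U, ‖f‖ ^ 2 ≤ C ^ 2 * ∑ i, ‖wd U i f‖ ^ 2 := by
  obtain ⟨C, hC, hP⟩ := poincare_test hU
  have key : ∀ f ∈ H10 U, ‖f‖ ≤ C.toReal * ∑ i, ‖wd U i f‖ := by
    rintro f ⟨-, hf⟩
    refine le_of_forall_pos_le_add fun δ hδ => ?_
    have hK : 0 < 2 * C.toReal + 1 := by positivity
    -- Replacing `f` by `φ` costs ε once for the function and `C` times ε for each of the two
    -- derivatives, in all (2C + 1)ε = δ.
    obtain ⟨φ, h0, h1⟩ := hf (ENNReal.ofReal (δ / (2 * C.toReal + 1)))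
      (ENNReal.ofReal_pos.2 (by positivity))
    set ε := δ / (2 * C.toReal + 1) with hε
    have h2 : eLpNorm f 2 (volume.restrict (U : Set Plane))
        ≤ C * ∑ i, (eLpNorm (wd U i f) 2 (volume.restrict (U : Set Plane)) + ENNReal.ofReal ε)
          + ENNReal.ofReal ε := by
      refine (eLpNorm_le_add_distL2 (Lp.aestronglyMeasurable f)
        φ.continuous.aestronglyMeasurable).trans (add_le_add ((hP φ).trans ?_) ?_)
      · gcongr with i
        refine (eLpNorm_le_add_distL2
          (∂_{e i} φ : 𝓓(U, ℂ)).continuous.aestronglyMeasurable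
          (Lp.aestronglyMeasurable (wd U i f))).trans ?_
        gcongr
        exact (h1 i).le
      · rw [distL2_comm]; exact h0.le
    have hfin : ∀ i ∈ Finset.univ, eLpNorm (wd U i f) 2 (volume.restrict (U : Set Plane))
        + ENNReal.ofReal ε ≠ ⊤ := fun i _ =>
      ENNReal.add_ne_top.2 ⟨(Lp.memLp _).2.ne, ENNReal.ofReal_ne_top⟩
    have hfin' := ENNReal.mul_ne_top hC (ENNReal.sum_ne_top.2 hfin)
    have hε0 : 0 ≤ ε := by positivity
    have h3 := ENNReal.toReal_mono (ENNReal.add_ne_top.2 ⟨hfin', ENNReal.ofReal_ne_top⟩) h2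
    rw [ENNReal.toReal_add hfin' ENNReal.ofReal_ne_top, ENNReal.toReal_mul,
      ENNReal.toReal_sum hfin, ENNReal.toReal_ofReal hε0] at h3
    have h4 : ∀ i, (eLpNorm (wd U i f) 2 (volume.restrict (U : Set Plane))
        + ENNReal.ofReal ε).toReal = ‖wd U i f‖ + ε := fun i => by
      rw [ENNReal.toReal_add (Lp.memLp _).2.ne ENNReal.ofReal_ne_top,
        ENNReal.toReal_ofReal hε0, Lp.norm_def]
    simp only [h4] at h3
    rw [← Lp.norm_def] at h3
    refine h3.trans_eq ?_
    have : (2 * C.toReal + 1) * ε = δ := by rw [hε]; field_simp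
    simp only [Fin.sum_univ_two]
    linear_combination this
  -- The factor 2 absorbs the square of the sum of two norms: (a + b)² ≤ 4(a² + b²), with room to
  -- spare.
  refine ⟨C.toReal * 2, fun f hf => ?_⟩
  have h := pow_le_pow_left₀ (norm_nonneg f) (key f hf) 2
  refine h.trans ?_
  simp only [Fin.sum_univ_two, mul_pow]
  rw [mul_assoc]
  gcongr
  nlinarith [sq_nonneg (‖wd U 0 f‖ - ‖wd U 1 f‖), sq_nonneg ‖wd U 0 f‖, sq_nonneg ‖wd U 1 f‖]

theorem H20.mem_H10 {f : L2 U} (hf : f ∈ H20 U) : f ∈ H10 U :=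
  ⟨hf.1.1, fun ε hε => let ⟨φ, h0, h1, _⟩ := hf.2 ε hε; ⟨φ, h0, h1⟩⟩

/-- The derivatives of the approximating test functions are test functions again. This lets
Poincaré's inequality be applied a second time, to the gradient. -/
theorem H20.wd_mem_H10 {f : L2 U} (hf : f ∈ H20 U) (i : Fin 2) : wd U i f ∈ H10 U :=
  ⟨hf.1.2 i, fun ε hε => let ⟨φ, _, h1, h2⟩ := hf.2 ε hε; ⟨∂_{e i} φ, h1 i, h2 i⟩⟩

theorem exists_seminorm_bound (hU : Bornology.IsBounded (U : Set Plane)) :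
    ∃ M : ℝ, 0 < M ∧ (∀ f ∈ H10 U, normH1Sq U f ≤ M * ∑ i, ‖wd U i f‖ ^ 2) ∧
      ∀ f ∈ H20 U, normH2Sq U f ≤ M * ∑ i, ∑ j, ‖wd U j (wd U i f)‖ ^ 2 := by
  obtain ⟨C, hC⟩ := poincare_H10 hU
  -- One application of Poincaré needs C² + 1, two need C⁴ + C² + 1; the square of C² + 1 dominates
  -- both.
  refine ⟨(C ^ 2 + 1) ^ 2, by positivity, fun f hf => ?_, fun f hf => ?_⟩
  · have h := hC f hf
    have h1 : 0 ≤ C ^ 2 * (C ^ 2 + 1) * ∑ i, ‖wd U i f‖ ^ 2 := by positivity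
    rw [normH1Sq]
    linear_combination h + h1
  · have h := hC f (H20.mem_H10 hf)
    have h2 : ∑ i, ‖wd U i f‖ ^ 2 ≤ C ^ 2 * ∑ i, ∑ j, ‖wd U j (wd U i f)‖ ^ 2 := by
      rw [Finset.mul_sum]
      exact Finset.sum_le_sum fun i _ => hC _ (H20.wd_mem_H10 hf i)
    have h3 : 0 ≤ C ^ 2 * ∑ i, ∑ j, ‖wd U j (wd U i f)‖ ^ 2 := by positivity
    have h4 := mul_le_mul_of_nonneg_left h2 (by positivity : 0 ≤ C ^ 2 + 1)
    rw [normH2Sq]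
    linear_combination h + h4 + h3

end poincare

/-! ## Local coercivity -/

section coercivity

variable {K : Polygon}

theorem integral_mul_conj_self {U : TopologicalSpace.Opens Plane} (f : L2 U) :
    ∫ x in (U : Set Plane), f x * conj (f x) = ((‖f‖ ^ 2 : ℝ) : ℂ) := by
  rw [norm_sq_eq_integral, ← integral_complex_ofReal]
  refine integral_congr_ae (Eventually.of_forall fun x => ?_)
  simp only [Complex.mul_conj, Complex.normSq_eq_norm_sq]

/-- Supplies both the realness and the nonnegativity of the diagonal values. -/
theorem aDelta_self (v : L2 K.interior) :
    aDelta K v v = ((∑ i, ∑ j, ‖wd K.interior j (wd K.interior i v)‖ ^ 2 : ℝ) : ℂ) := by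
  rw [Complex.ofReal_sum]
  refine Finset.sum_congr rfl fun i _ => ?_
  rw [Complex.ofReal_sum]
  exact Finset.sum_congr rfl fun j _ => integral_mul_conj_self _

theorem aNabla_self (ψ : L2 K.interior) :
    aNabla K ψ ψ = ((∑ i, ‖wd K.interior i ψ‖ ^ 2 : ℝ) : ℂ) := by
  rw [Complex.ofReal_sum]
  exact Finset.sum_congr rfl fun i _ => integral_mul_conj_self _

theorem norm_add_sq_le_two_mul {E : Type*} [SeminormedAddCommGroup E] (a b : E) :
    ‖a + b‖ ^ 2 ≤ 2 * (‖a‖ ^ 2 + ‖b‖ ^ 2) := by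
  have h := pow_le_pow_left₀ (norm_nonneg _) (norm_add_le a b) 2
  linear_combination h + sq_nonneg (‖a‖ - ‖b‖)

theorem aDelta_add_self_le {u v : L2 K.interior} (hu : u ∈ H2 K.interior)
    (hv : v ∈ H2 K.interior) :
    (aDelta K (u + v) (u + v)).re ≤ 2 * ((aDelta K u u).re + (aDelta K v v).re) := by
  simp only [aDelta_self, Complex.ofReal_re, ← Finset.sum_add_distrib, Finset.mul_sum]
  refine Finset.sum_le_sum fun i _ => Finset.sum_le_sum fun j _ => ?_
  rw [wd_add hu.1 hv.1, wd_add (hu.2 i) (hv.2 i)]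
  exact norm_add_sq_le_two_mul _ _

theorem aNabla_add_self_le {u v : L2 K.interior} (hu : u ∈ H1 K.interior)
    (hv : v ∈ H1 K.interior) :
    (aNabla K (u + v) (u + v)).re ≤ 2 * ((aNabla K u u).re + (aNabla K v v).re) := by
  simp only [aNabla_self, Complex.ofReal_re, ← Finset.sum_add_distrib, Finset.mul_sum]
  refine Finset.sum_le_sum fun i _ => ?_
  rw [wd_add hu hv]
  exact norm_add_sq_le_two_mul _ _

/-- Membership in `WLoc` already provides a projection, so the default value 0 of `projDelta` does
not occur here. -/
theorem isProjDelta_projDelta (v : WLoc K) : IsProjDelta K v (projDelta K v) := by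
  have h : ∃ p, IsProjDelta K v p := let ⟨_, p, hp, _⟩ := v.2; ⟨p, hp⟩
  rw [projDelta, dif_pos h]
  exact h.choose_spec

theorem isProjNabla_projNabla (ψ : VLoc K) : IsProjNabla K ψ (projNabla K ψ) := by
  have h : ∃ p, IsProjNabla K ψ p := let ⟨_, p, hp, _⟩ := ψ.2; ⟨p, hp⟩
  rw [projNabla, dif_pos h]
  exact h.choose_spec

/-- The relation `IsProjDelta` is linear and a quadratic polynomial is its own projection;
subtracting gives 0, with no appeal to uniqueness. The stability bounds thereby become available for
the projection error. -/
theorem isProjDelta_sub_projW (v : WLoc K) : IsProjDelta K (v - projW K v : WLoc K) 0 := by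
  have h := (isProjDelta_projDelta v).add v.2.1.1 ((H2 _).smul_mem (-1) (polyL2_mem_H2 K _))
    ((isProjDelta_polyL2 K (projDelta_mem K v)).smul (-1) (polyL2_mem_H2 K _))
  simpa [projW, sub_eq_add_neg] using h

theorem isProjNabla_sub_projV (ψ : VLoc K) : IsProjNabla K (ψ - projV K ψ : VLoc K) 0 := by
  have h := (isProjNabla_projNabla ψ).add ψ.2.1.1 ((H1 _).smul_mem (-1) (polyL2_mem_H1 K _))
    ((isProjNabla_polyL2 K (projNabla_mem K ψ)).smul (-1) (polyL2_mem_H1 K _))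
  simpa [projV, sub_eq_add_neg] using h

/-! ### Realness and lower bounds of the local discrete forms. -/

theorem IsSPD.im_self {W : Type*} [AddCommGroup W] [Module ℂ W] {s : W →ₗ[ℂ] W →ₗ⋆[ℂ] ℂ}
    (h : IsSPD s) (u : W) : (s u u).im = 0 :=
  Complex.conj_eq_iff_im.1 (h.1 u u).symm

theorem aDeltaH_im {s : WLoc K →ₗ[ℂ] WLoc K →ₗ⋆[ℂ] ℂ} (hs : IsSPD s) (v : WLoc K) :
    (aDeltaH K s v v).im = 0 := by
  rw [aDeltaH, Complex.add_im, hs.im_self, aDelta_self, Complex.ofReal_im, add_zero]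

theorem aNablaH_im {s : VLoc K →ₗ[ℂ] VLoc K →ₗ⋆[ℂ] ℂ} (hs : IsSPD s) (ψ : VLoc K) :
    (aNablaH K s ψ ψ).im = 0 := by
  rw [aNablaH, Complex.add_im, hs.im_self, aNabla_self, Complex.ofReal_im, add_zero]

/-- The polynomial part needs only m ≤ 1; the projection error is controlled by the lower stability
bound and needs m ≤ c₀. The halving pays for the triangle inequality. -/
theorem IsStabDelta.le_aDeltaH {s : WLoc K →ₗ[ℂ] WLoc K →ₗ⋆[ℂ] ℂ} {c₀ c₁ m : ℝ}
    (hs : IsStabDelta K s c₀ c₁) (hm : 0 ≤ m) (hm1 : m ≤ 1) (hmc : m ≤ c₀) (v : WLoc K) :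
    m / 2 * (aDelta K v v).re ≤ (aDeltaH K s v v).re := by
  have h1 := (hs.2 _ (isProjDelta_sub_projW v)).1
  have h2 := aDelta_add_self_le (projW K v).2.1.1 (v - projW K v).2.1.1
  -- Recombines the projection and its error into `v` on the left-hand side.
  rw [← Submodule.coe_add, add_sub_cancel] at h2
  have nn : ∀ u : L2 K.interior, 0 ≤ (aDelta K u u).re := fun u => by
    rw [aDelta_self, Complex.ofReal_re]; positivity
  rw [aDeltaH, Complex.add_re]
  have h3 := mul_le_mul_of_nonneg_left h2 hm
  have h4 := mul_le_mul_of_nonneg_right hm1 (nn (projW K v))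
  have h5 := mul_le_mul_of_nonneg_right hmc (nn (v - projW K v : WLoc K))
  linear_combination h3 / 2 + h4 + h5 + h1

theorem IsStabNabla.le_aNablaH {s : VLoc K →ₗ[ℂ] VLoc K →ₗ⋆[ℂ] ℂ} {c₂ c₃ m : ℝ}
    (hs : IsStabNabla K s c₂ c₃) (hm : 0 ≤ m) (hm1 : m ≤ 1) (hmc : m ≤ c₂) (ψ : VLoc K) :
    m / 2 * (aNabla K ψ ψ).re ≤ (aNablaH K s ψ ψ).re := by
  have h1 := (hs.2 _ (isProjNabla_sub_projV ψ)).1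
  have h2 := aNabla_add_self_le (projV K ψ).2.1.1 (ψ - projV K ψ).2.1.1
  rw [← Submodule.coe_add, add_sub_cancel] at h2
  have nn : ∀ u : L2 K.interior, 0 ≤ (aNabla K u u).re := fun u => by
    rw [aNabla_self, Complex.ofReal_re]; positivity
  rw [aNablaH, Complex.add_re]
  have h3 := mul_le_mul_of_nonneg_left h2 hm
  have h4 := mul_le_mul_of_nonneg_right hm1 (nn (projV K ψ))
  have h5 := mul_le_mul_of_nonneg_right hmc (nn (ψ - projV K ψ : VLoc K))
  linear_combination h3 / 2 + h4 + h5 + h1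

end coercivity

/-! ## Summation over the mesh -/

section global

variable {Ω : TopologicalSpace.Opens Plane} (T : Mesh Ω)

/-- For each pair of indices the sum over elements is additivity of the squared L² norm of one
second derivative; restriction passes through both differentiations. -/
theorem sum_aDelta_restr {v : L2 Ω} (hv : v ∈ H2 Ω) :
    ∑ k, (aDelta (T.elem k) (restr (T.le k) v) (restr (T.le k) v)).re
      = ∑ i, ∑ j, ‖wd Ω j (wd Ω i v)‖ ^ 2 := by
  simp only [aDelta_self, Complex.ofReal_re]
  rw [Finset.sum_comm]
  refine Finset.sum_congr rfl fun i _ => ?_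
  rw [Finset.sum_comm]
  refine Finset.sum_congr rfl fun j _ => ?_
  rw [← T.sum_norm_restr_sq]
  exact Finset.sum_congr rfl fun k _ => by rw [wd_restr _ hv.1, wd_restr _ (hv.2 i)]

theorem sum_aNabla_restr {ψ : L2 Ω} (hψ : ψ ∈ H1 Ω) :
    ∑ k, (aNabla (T.elem k) (restr (T.le k) ψ) (restr (T.le k) ψ)).re
      = ∑ i, ‖wd Ω i ψ‖ ^ 2 := by
  simp only [aNabla_self, Complex.ofReal_re]
  rw [Finset.sum_comm]
  refine Finset.sum_congr rfl fun i _ => ?_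
  rw [← T.sum_norm_restr_sq]
  exact Finset.sum_congr rfl fun k _ => by rw [wd_restr _ hψ]

end global

end VEM

/-! ### Global coercivity. -/

theorem mainTheorem6 (Ω : TopologicalSpace.Opens VEM.Plane) (hΩ : VEM.IsPolygonalDomain Ω)
    (CT : ℝ) (hCT : 0 < CT)
    (c₀ c₁ c₂ c₃ : ℝ) (hc₀ : 0 < c₀) (hc₁ : 0 < c₁) (hc₂ : 0 < c₂) (hc₃ : 0 < c₃) :
    ∃ β : ℝ, 0 < β ∧
      ∀ T : VEM.Mesh Ω, T.A1 CT → T.A2 CT →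
      ∀ (sΔ : ∀ k, VEM.WLoc (T.elem k) →ₗ[ℂ] VEM.WLoc (T.elem k) →ₗ⋆[ℂ] ℂ)
        (sN : ∀ k, VEM.VLoc (T.elem k) →ₗ[ℂ] VEM.VLoc (T.elem k) →ₗ⋆[ℂ] ℂ),
        (∀ k, VEM.IsStabDelta (T.elem k) (sΔ k) c₀ c₁) →
        (∀ k, VEM.IsStabNabla (T.elem k) (sN k) c₂ c₃) →
        ∀ z : VEM.Z T,
          (VEM.aH T sΔ sN z z).im = 0 ∧
          β * VEM.prodNorm Ω z.1 z.2 ^ 2 ≤ (VEM.aH T sΔ sN z z).re := by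
  obtain ⟨M, hM, hM1, hM2⟩ := VEM.exists_seminorm_bound hΩ.2.1
  -- The 1 serves the polynomial parts, c₀ and c₂ the stabilized ones; a single `m` lets both
  -- components be summed together.
  set m := min 1 (min c₀ c₂) with hm
  have hm0 : 0 < m := lt_min one_pos (lt_min hc₀ hc₂)
  have hm1 : m ≤ 1 := min_le_left _ _
  have hmc₀ : m ≤ c₀ := (min_le_right _ _).trans (min_le_left _ _)
  have hmc₂ : m ≤ c₂ := (min_le_right _ _).trans (min_le_right _ _)
  -- `m / 2` is lost in the local estimate and `M` in Poincaré's inequality; both are fixed before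
  -- the mesh and the stabilizations are introduced.
  refine ⟨m / 2 / M, by positivity, fun T _ _ sΔ sN hΔ hN z => ⟨?_, ?_⟩⟩
  · rw [VEM.aH, Complex.im_sum]
    refine Finset.sum_eq_zero fun k _ => ?_
    rw [Complex.add_im, VEM.aDeltaH_im (hΔ k).1, VEM.aNablaH_im (hN k).1, add_zero]
  · obtain ⟨⟨v, hv⟩, ⟨ψ, hψ⟩⟩ := z
    have h1 := hM1 ψ hψ.1
    have h2 := hM2 v hv.1
    have hnn : 0 ≤ VEM.normH2Sq Ω v + VEM.normH1Sq Ω ψ := by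
      unfold VEM.normH2Sq VEM.normH1Sq
      positivity
    rw [VEM.prodNorm, Real.sq_sqrt hnn, VEM.aH, Complex.re_sum]
    calc m / 2 / M * (VEM.normH2Sq Ω v + VEM.normH1Sq Ω ψ)
        ≤ m / 2 / M * (M * (∑ i, ∑ j, ‖VEM.wd Ω j (VEM.wd Ω i v)‖ ^ 2)
            + M * ∑ i, ‖VEM.wd Ω i ψ‖ ^ 2) := by gcongr
      _ = m / 2 * (∑ i, ∑ j, ‖VEM.wd Ω j (VEM.wd Ω i v)‖ ^ 2)
            + m / 2 * ∑ i, ‖VEM.wd Ω i ψ‖ ^ 2 := by field_simp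
      _ ≤ _ := by
        rw [← VEM.sum_aDelta_restr T hv.1.1, ← VEM.sum_aNabla_restr T hψ.1.1, Finset.mul_sum,
          Finset.mul_sum, ← Finset.sum_add_distrib]
        refine Finset.sum_le_sum fun k _ => ?_
        rw [Complex.add_re]
        exact add_le_add
          ((hΔ k).le_aDeltaH hm0.le hm1 hmc₀ (VEM.restrW T k ⟨v, hv⟩))
          ((hN k).le_aNablaH hm0.le hm1 hmc₂ (VEM.restrV T k ⟨ψ, hψ⟩))
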